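/- **Setting.** Let $e_1,e_2,e_3$ be the standard basis of $\mathbb R^3$, $|\cdot|$ the Euclidean norm, $T^3=\mathbb R^3/\mathbb Z^3$, and identify $H_1(T^3,\mathbb R)=\mathbb R^3$. Put $l_1=\mathbb R\times\{0\}\times\{0\}$, $l_2=\{0\}\times\mathbb R\times\{\tfrac12\}$, $l_3=\{\tfrac12\}\times\{\tfrac12\}\times\mathbb R$, $L_i=l_i+\mathbb Z^3$, $L=L_1\cup L_2\cup L_3$, and let $B_\varepsilon(\cdot)$ denote open Euclidean $\varepsilon$-neighbourhoods. Let $(v_1,v_2,v_3)$ be an orthonormal basis with $v_1=\tfrac1{\sqrt3}(1,1,1)$ and let $(v_1^*,v_2^*,v_3^*)$ be the dual basis. Let $\lambda_1,\lambda_2,\lambda_3>0$ with $\sum\lambda_i=1$, and let $0<\varepsilon<10^{-2}$ with $3\varepsilon^2<(1-2\varepsilon^2)\lambda_i^2$ for $i=1,2,3$. Put $$g_\varepsilon=-\tfrac{\varepsilon^2}{4}\,v_1^*\otimes v_1^*+v_2^*\otimes v_2^*+v_3^*\otimes v_3^*,\qquad g_i=\lambda_i^2\Big(-(dx^i)^2+\tfrac13\sum_{j\ne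 i}(dx^j)^2\Big).$$ For Lorentzian inner products write $a\ge b$ if $a(v,v)\le b(v,v)$ for every $v$ with $b(v,v)\le 0$. Let $g$ be a smooth Lorentzian metric on $T^3$ whose lift $\overline g$ to $\mathbb R^3$ satisfies 1. $\overline g_p\ge g_\varepsilon$ for all $p\in\mathbb R^3$; 2. $g_{2\varepsilon}\ge\overline g_p$ for all $p\in\mathbb R^3\setminus B_\varepsilon(L)$; 3. for $p\in B_\varepsilon(L_i)$, $g_i\ge\overline g_p$, with equality exactly on $L_i$: if $p\in L_i$ then $\overline g_p=g_i$, and if $p\notin L_i$ then $g_i(v,v)<\overline g_p(v,v)$ for all $v\neq0$ with $\overline g_p(v,v)\le0$. By 1, $v_1$ is timelike everywhere; it fixes the time orientation. A future pointing curve is a Lipschitz curve $\gamma\colon[a,b]\to\mathbb R^3$, $a<b$, whose derivative is almost everywhere a (nonzero) future pointing causal vector; $L^g(\gamma)=\int\sqrt{|\overline g(\dot\gamma,\dot\gamma)|}\,dt$, $L^{R}(\gamma)=\int|\dot\gamma|\,dt$, and $d(p,q)$ is the supremum of $L^g(\gamma)$ over the future pointing curves from $p$ to $q$ ($\sup\emptyset=0$).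 The *stable time cone* $\mathfrak T\subset\mathbb R^3$ is the cone over the set of accumulation points of sequences $(\gamma_n(b_n)-\gamma_n(a_n))/L^{R}(\gamma_n)$, where $\gamma_n\colon[a_n,b_n]\to\mathbb R^3$ are future pointing curves with $L^{R}(\gamma_n)\to\infty$. For $\delta>0$ let $\mathfrak T_\delta=\{h\in\mathfrak T:\operatorname{dist}(h,\partial\mathfrak T)\ge\delta|h|\}$. A *stable time separation* is a concave function $\mathfrak l\colon\mathfrak T\to\mathbb R$ such that for every $\delta>0$ there is $C(\delta)<\infty$ with $|\mathfrak l(y-x)-d(x,y)|\le C(\delta)$ whenever $y-x\in\mathfrak T_\delta$, such that $\mathfrak l(ch)=c\,\mathfrak l(h)$ for $c\ge0$ and $\mathfrak l(h+h')\ge\mathfrak l(h)+\mathfrak l(h')$, and such that $\mathfrak l(h)=\limsup_{h'\to h,\,h'\in\mathfrak T}\mathfrak l(h')$ for $h\in\partial\mathfrak T\cap\mathfrak T$. The *pregeodesic flow* $\Phi$ on the Euclidean unit tangent bundle $T^3\times S^2$ moves a unit vector along the tangent curve of the $g$-geodesic that it generates, parametrized by Euclidean arclength. For a finite Borel measure $\mu$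 on $T^3\times S^2$ put $\rho(\mu)=\int v\,d\mu\in H_1(T^3,\mathbb R)$ and, if $\mu$ is carried by future pointing causal vectors, $\mathfrak L(\mu)=\int\sqrt{-g(v,v)}\,d\mu$. A *maximal ergodic measure* is a $\Phi$-invariant ergodic probability measure carried by the future pointing causal vectors with $\mathfrak L(\mu)=\mathfrak l(\rho(\mu))$. **Proposition.** For every such $g$: (a) $\mathfrak T=\operatorname{pos}\{e_1,e_2,e_3\}$, the convex cone generated by $e_1,e_2,e_3$. (b) There is exactly one stable time separation, namely $\mathfrak l(h)=\sum_i\lambda_ih^i$ for $h\in\operatorname{pos}\{e_1,e_2,e_3\}$. (c) The pregeodesic flow exists for all times, and there are exactly three maximal ergodic measures $\mu_1,\mu_2,\mu_3$. The line $l_i$, parametrized with velocity $e_i$, projects to a closed future pointing timelike geodesic of $(T^3,g)$ of period $1$; $\mu_i$ is the uniform probability measure on its tangent curve, and the support of $\mu_i$ is that tangent curve. -/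

import Mathlib

open Set Filter Topology MeasureTheory
open scoped ContDiff ENNReal

noncomputable section

namespace Hedlund

/-- `ℝ³` with the flat background metric `g_R`; it is the Abelian cover of `T³`, and also
`H₁(T³, ℝ)`, with the Euclidean norm as stable norm. -/
abbrev E3 : Type := EuclideanSpace ℝ (Fin 3)

/-- `T³ = ℝ³ / ℤ³`. -/
abbrev T3 : Type := UnitAddTorus (Fin 3)

/-- The covering map `ℝ³ → T³`. -/
def proj (x : E3) : T3 := fun i => (x i : UnitAddCircle)

/-- The unit tangent bundle of the flat torus, in its canonical trivialization. -/
abbrev UT : Type := T3 × Metric.sphere (0 : E3) 1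

/-- The standard basis of `ℝ³`. -/
def stdE (i : Fin 3) : E3 := EuclideanSpace.single i 1

/-- `v₁ = (1, 1, 1) / √3`. -/
def vOne : E3 := (1 / √3 : ℝ) • (stdE 0 + stdE 1 + stdE 2)

/-! ### Lorentzian metrics on the torus -/

/-- A smooth Lorentzian metric on `T³`, of signature `(-, +, +)`, in the canonical trivialization
of the tangent bundle. -/
structure LorentzMetric where
  /-- the metric tensor -/
  form : T3 → E3 →L[ℝ] E3 →L[ℝ] ℝ
  smooth : ContDiff ℝ ∞ (fun x : E3 => form (proj x))
  symm : ∀ p v w, form p v w = form p w v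
  signature : ∀ p, ∃ v, form p v v < 0 ∧ ∀ w, w ≠ 0 → form p v w = 0 → 0 < form p w w

/-- The lifted, `ℤ³`-invariant metric on `ℝ³`. -/
def LorentzMetric.lift (g : LorentzMetric) (x : E3) : E3 →L[ℝ] E3 →L[ℝ] ℝ := g.form (proj x)

/-- Future pointing causal vectors over a point of `T³`, for the time orientation given by `v₁`. -/
def FutureCausal (g : LorentzMetric) (p : T3) (v : E3) : Prop :=
  v ≠ 0 ∧ g.form p v v ≤ 0 ∧ g.form p v vOne < 0

/-- Future pointing curves `[a, b] → ℝ³`: Lipschitz, with future pointing causal derivative almost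
everywhere. -/
def IsFuturePointing (g : LorentzMetric) (γ : ℝ → E3) (a b : ℝ) : Prop :=
  a < b ∧ (∃ K, LipschitzOnWith K γ (Icc a b)) ∧
    ∀ᵐ t ∂(volume.restrict (Icc a b)), DifferentiableAt ℝ γ t ∧
      FutureCausal g (proj (γ t)) (deriv γ t)

/-- The length with respect to `g_R`. -/
def riemLength (γ : ℝ → E3) (a b : ℝ) : ℝ := ∫ t in a..b, ‖deriv γ t‖

/-- The Lorentzian length. -/
def lorentzLength (g : LorentzMetric) (γ : ℝ → E3) (a b : ℝ) : ℝ :=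
  ∫ t in a..b, √|g.lift (γ t) (deriv γ t) (deriv γ t)|

/-- The time separation of `ℝ³` with the lifted metric (`0` if there is no future pointing curve
from `p` to `q`). -/
def timeSep (g : LorentzMetric) (p q : E3) : ℝ≥0∞ :=
  ⨆ (γ : ℝ → E3) (a : ℝ) (b : ℝ) (_ : IsFuturePointing g γ a b ∧ γ a = p ∧ γ b = q),
    ENNReal.ofReal (lorentzLength g γ a b)

/-! ### Stable time cone and stable time separation -/

/-- The accumulation points of the rotation vectors (displacement per unit of `g_R`-length) of
sequences of future pointing curves whose `g_R`-lengths tend to infinity. -/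
def stableTimeConeOne (g : LorentzMetric) : Set E3 :=
  {h | ∃ (γ : ℕ → ℝ → E3) (a b : ℕ → ℝ), (∀ n, IsFuturePointing g (γ n) (a n) (b n)) ∧
    Tendsto (fun n => riemLength (γ n) (a n) (b n)) atTop atTop ∧
    MapClusterPt h atTop
      (fun n => (riemLength (γ n) (a n) (b n))⁻¹ • (γ n (b n) - γ n (a n)))}

/-- The stable time cone: the cone over `stableTimeConeOne`. -/
def stableTimeCone (g : LorentzMetric) : Set E3 :=
  {h | ∃ c : ℝ, 0 ≤ c ∧ ∃ k ∈ stableTimeConeOne g, h = c • k}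

/-- The elements of a cone `T` at distance at least `δ ‖h‖` from its boundary. -/
def innerCone (T : Set E3) (δ : ℝ) : Set E3 :=
  {h | h ∈ T ∧ δ * ‖h‖ ≤ Metric.infDist h (frontier T)}

/-- The properties that define the stable time separation. Only the values of `l` on the
stable time cone matter. -/
structure IsStableTimeSeparation (g : LorentzMetric) (l : E3 → ℝ) : Prop where
  concave : ConcaveOn ℝ (stableTimeCone g) l
  close : ∀ δ > 0, ∃ C : ℝ, ∀ x y : E3, y - x ∈ innerCone (stableTimeCone g) δ →
    timeSep g x y ≠ ⊤ ∧ |l (y - x) - (timeSep g x y).toReal| ≤ C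
  homogeneous : ∀ c : ℝ, 0 ≤ c → ∀ h ∈ stableTimeCone g, l (c • h) = c * l h
  superadditive : ∀ h ∈ stableTimeCone g, ∀ h' ∈ stableTimeCone g, l h' + l h ≤ l (h' + h)
  boundary : ∀ h ∈ frontier (stableTimeCone g), h ∈ stableTimeCone g →
    (l h : EReal) = limsup (fun h' => (l h' : EReal)) (𝓝[stableTimeCone g] h)

/-! ### Geodesics and the pregeodesic flow -/

/-- `ḡ(∇_{γ'} γ', w)` for the Levi-Civita connection of the lifted metric `ḡ`, where `γ` passes
through `x` with velocity `v` and second derivative `a` (Koszul formula in coordinates):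
`ḡ(a, w) + (D_v ḡ)(v, w) - (D_w ḡ)(v, v) / 2`. -/
def covAccel (g : LorentzMetric) (x v a w : E3) : ℝ :=
  g.lift x a w + fderiv ℝ g.lift x v v w - 1 / 2 * fderiv ℝ g.lift x w v v

/-- Geodesics of the lifted metric: `∇_{γ'} γ' = 0`. -/
def IsGeodesic (g : LorentzMetric) (γ : ℝ → E3) : Prop :=
  ContDiff ℝ 2 γ ∧ ∀ t w, covAccel g (γ t) (deriv γ t) (deriv (deriv γ) t) w = 0

/-- Pregeodesics of the lifted metric that are parametrized by `g_R`-arclength: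
`‖γ'‖ = 1` and `∇_{γ'} γ'` is a multiple of `γ'`. -/
def IsUnitPregeodesic (g : LorentzMetric) (γ : ℝ → E3) : Prop :=
  ContDiff ℝ 2 γ ∧ (∀ t, ‖deriv γ t‖ = 1) ∧
    ∀ t, ∃ c : ℝ, ∀ w, covAccel g (γ t) (deriv γ t) (deriv (deriv γ) t) w =
      c * g.lift (γ t) (deriv γ t) w

/-- `Φ` is the pregeodesic flow on the unit tangent bundle: the orbit of `z` is the tangent curve
of the pregeodesic with initial velocity `z` that is parametrized by `g_R`-arclength. -/
def IsPregeodesicFlow (g : LorentzMetric) (Φ : ℝ → UT → UT) : Prop :=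
  ∀ z : UT, Φ 0 z = z ∧ ∃ γ : ℝ → E3, IsUnitPregeodesic g γ ∧
    ∀ t, (Φ t z).1 = proj (γ t) ∧ ((Φ t z).2 : E3) = deriv γ t

/-! ### Invariant measures -/

/-- The rotation class `ρ(μ)`: its pairing with the class of `dxⁱ` is the integral of `dxⁱ`. -/
def rotationClass (μ : Measure UT) : E3 := WithLp.toLp 2 fun i => ∫ z, (z.2 : E3) i ∂μ

/-- The average length `𝔏(μ)`. -/
def averageLength (g : LorentzMetric) (μ : Measure UT) : ℝ :=
  ∫ z, √(-(g.form z.1 (z.2 : E3) (z.2 : E3))) ∂μ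

/-- Maximal ergodic measures: probability measures that are invariant and ergodic under the flow
`Φ`, live on the future pointing causal vectors and satisfy `𝔏(μ) = l(ρ(μ))`. -/
structure IsMaximalErgodic (g : LorentzMetric) (Φ : ℝ → UT → UT) (l : E3 → ℝ)
    (μ : Measure UT) : Prop where
  prob : IsProbabilityMeasure μ
  invariant : ∀ t, MeasurePreserving (Φ t) μ μ
  ergodic : ∀ A : Set UT, MeasurableSet A → (∀ t, Φ t ⁻¹' A = A) → μ A = 0 ∨ μ Aᶜ = 0
  future : ∀ᵐ z ∂μ, FutureCausal g z.1 (z.2 : E3)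
  maximal : averageLength g μ = l (rotationClass μ)

/-! ### The Hedlund metrics -/

/-- Base points of the lines `l₁`, `l₂`, `l₃`. -/
def basePt : Fin 3 → E3 := ![!₂[0, 0, 0], !₂[0, 0, 1 / 2], !₂[1 / 2, 1 / 2, 0]]

/-- The line `l_i`, parametrized by `t ↦ basePt i + t e_i`. -/
def line (i : Fin 3) (t : ℝ) : E3 := basePt i + t • stdE i

/-- The family `L_i = l_i + ℤ³`. -/
def lineFamily (i : Fin 3) : Set E3 :=
  {x | ∃ (t : ℝ) (k : Fin 3 → ℤ), x = line i t + WithLp.toLp 2 fun j => (k j : ℝ)}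

/-- The quadratic form of `g_ε = -(ε²/4) v₁* ⊗ v₁* + v₂* ⊗ v₂* + v₃* ⊗ v₃*`, where `(v₁, v₂, v₃)` is
an orthonormal basis; the last two terms are the square of the norm of the part orthogonal to
`v₁`. -/
def flatForm (ε : ℝ) (v : E3) : ℝ :=
  -(ε ^ 2 / 4) * (inner ℝ vOne v) ^ 2 + (‖v‖ ^ 2 - (inner ℝ vOne v) ^ 2)

/-- The quadratic form of `g_i = λ_i² (-(dxⁱ)² + ∑_{j ≠ i} (dxʲ)² / 3)`. -/
def tubeForm (lam : Fin 3 → ℝ) (i : Fin 3) (v : E3) : ℝ :=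
  lam i ^ 2 * (-(v i) ^ 2 + ∑ j ∈ Finset.univ.erase i, 1 / 3 * (v j) ^ 2)

/-- The relation `q ≥ q'` between (the quadratic forms of) Lorentzian inner products: every
`q'`-causal vector is `q`-causal, with at least the same `q`-length. -/
def Dominates (q q' : E3 → ℝ) : Prop := ∀ v, q' v ≤ 0 → q v ≤ q' v

/-- The Lorentzian Hedlund metrics. In the third condition the comparison `g_i ≥ ḡ_p` holds on the
`ε`-tube around `L_i`, with equality exactly for `p ∈ L_i`. -/
structure IsHedlundMetric (lam : Fin 3 → ℝ) (ε : ℝ) (g : LorentzMetric) : Prop where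
  lower : ∀ p : E3, Dominates (fun v => g.lift p v v) (flatForm ε)
  upper_off : ∀ p : E3, p ∉ Metric.thickening ε (⋃ i, lineFamily i) →
    Dominates (flatForm (2 * ε)) (fun v => g.lift p v v)
  upper_on : ∀ i, ∀ p ∈ Metric.thickening ε (lineFamily i),
    (p ∈ lineFamily i → ∀ v, g.lift p v v = tubeForm lam i v) ∧
    (p ∉ lineFamily i → ∀ v, v ≠ 0 → g.lift p v v ≤ 0 → tubeForm lam i v < g.lift p v v)

/-- The unit vector `e_i` as a point of the sphere. -/
def stdS (i : Fin 3) : Metric.sphere (0 : E3) 1 := ⟨stdE i, by simp [stdE]⟩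

/-- The tangent curve, in the unit tangent bundle of `T³`, of the projection of `l_i`. -/
def tangentLine (i : Fin 3) (t : ℝ) : UT := (proj (line i t), stdS i)

/-- The uniform probability measure on the closed orbit `tangentLine i`, of period `1`. -/
def lineMeasure (i : Fin 3) : Measure UT :=
  Measure.map (tangentLine i) (volume.restrict (Icc (0 : ℝ) 1))

end Hedlund

end

/-!
Correct each coordinate `x_j` by a periodic function so that it becomes locally constant near the
lines `L_i` with `i ≠ j`. The resulting potentials `f_j` stay at bounded distance from the
coordinates and calibrate the metric: along a future pointing curve each of them is nondecreasing,
and `∑ λ_j f_j` grows at least as fast as the Lorentzian length, strictly faster except where the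
curve runs along some `L_i`. Hence `d(x, y) ≤ ∑ λ_j (y - x)^j + C`, and the displacement of a future
pointing curve stays at bounded distance from the octant. Conversely, bounded causal segments in
directions near `v₁` lead from any point to each of the lines, so a polygonal curve can follow the
three lines one after the other; this realizes the displacements deep in the octant up to a bounded
loss of length.

A maximal ergodic measure gives equality in the calibration inequality integrated over unit orbit
pieces. So almost every orbit meets one of the three closed orbits, hence is contained in it, and by
ergodicity the measure is the uniform measure on one of them.
-/

noncomputable section

namespace Hedlund

/-! ### The model quadratic forms -/

lemma stdE_apply (i j : Fin 3) : stdE i j = if j = i then 1 else 0 := by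
  simp [stdE, PiLp.single_apply]

@[simp] lemma vOne_apply (j : Fin 3) : vOne j = 1 / √3 := by
  fin_cases j <;> simp [vOne, stdE]

lemma inner_vOne (v : E3) : inner ℝ vOne v = (∑ j, v j) / √3 := by
  simp only [PiLp.inner_apply, vOne_apply, RCLike.inner_apply, conj_trivial, ← Finset.sum_mul]
  ring

lemma norm_vOne : ‖vOne‖ = 1 := by
  rw [EuclideanSpace.norm_eq]
  simp

lemma inner_vOne_self : inner ℝ vOne vOne = (1 : ℝ) := by
  rw [real_inner_self_eq_norm_sq, norm_vOne, one_pow]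

lemma flatForm_vOne (ε : ℝ) : flatForm ε vOne = -(ε ^ 2 / 4) := by
  rw [flatForm, inner_vOne_self, norm_vOne]
  ring

lemma flatForm_add_smul_vOne (ε : ℝ) (v : E3) (s : ℝ) :
    flatForm ε (v + s • vOne) =
      flatForm ε v - ε ^ 2 / 4 * (s * (2 * inner ℝ vOne v + s)) := by
  have hinner : inner ℝ vOne (v + s • vOne) = inner ℝ vOne v + s := by
    rw [inner_add_right, inner_smul_right, inner_vOne_self, mul_one]
  have hnorm : ‖v + s • vOne‖ ^ 2 = ‖v‖ ^ 2 + 2 * s * inner ℝ vOne v + s ^ 2 := by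
    rw [norm_add_sq_real, inner_smul_right, real_inner_comm, norm_smul, norm_vOne, mul_one,
      Real.norm_eq_abs, sq_abs]
    ring
  rw [flatForm, flatForm, hinner, hnorm]
  ring

lemma eq_zero_of_flatForm_nonpos {ε : ℝ} {v : E3} (h : flatForm ε v ≤ 0)
    (h1 : inner ℝ vOne v = 0) : v = 0 := by
  rw [flatForm, h1] at h
  simpa using h

/-- Cauchy–Schwarz against `e_i - v₁ / √3`, the part of `e_i` orthogonal to `v₁`, whose square norm
is `2 / 3`. -/
lemma sq_coord_sub_le (v : E3) (i : Fin 3) :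
    3 / 2 * (v i - inner ℝ vOne v / √3) ^ 2 ≤ ‖v‖ ^ 2 - inner ℝ vOne v ^ 2 := by
  have h3 : √3 ^ 2 = (3 : ℝ) := Real.sq_sqrt (by norm_num)
  have hmean : inner ℝ vOne v / √3 = (v 0 + v 1 + v 2) / 3 := by
    rw [inner_vOne, div_div, ← sq, h3, Fin.sum_univ_three]
  have hsq : inner ℝ vOne v ^ 2 = (v 0 + v 1 + v 2) ^ 2 / 3 := by
    rw [inner_vOne, div_pow, h3, Fin.sum_univ_three]
  rw [hmean, hsq, EuclideanSpace.real_norm_sq_eq, Fin.sum_univ_three]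
  fin_cases i <;> simp only [Fin.zero_eta, Fin.mk_one, Fin.reduceFinMk] <;>
    nlinarith [sq_nonneg (v 0 - v 1), sq_nonneg (v 0 - v 2), sq_nonneg (v 1 - v 2)]

lemma coord_le_two_mul_of_flatForm {ε : ℝ} (hε : 0 < ε) (hε' : ε < 1 / 100) {v : E3}
    (h : flatForm (2 * ε) v ≤ 0) (h1 : 0 < inner ℝ vOne v) (j k : Fin 3) : v k ≤ 2 * v j := by
  set t := inner ℝ vOne v with ht
  have hdist (i : Fin 3) : |v i - t / √3| ≤ ε * t := by
    refine abs_le_of_sq_le_sq ?_ (by positivity)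
    rw [flatForm] at h
    linarith [sq_coord_sub_le v i, sq_nonneg (v i - t / √3)]
  have hsqrt : t / 2 ≤ t / √3 := by
    gcongr
    exact Real.sqrt_le_iff.2 ⟨by norm_num, by norm_num⟩
  have hεt : ε * t ≤ 1 / 100 * t := by gcongr
  linarith [abs_le.1 (hdist j), abs_le.1 (hdist k)]

lemma neg_flatForm_lt_sq {ε l : ℝ} (hsmall : 3 * ε ^ 2 < (1 - 2 * ε ^ 2) * l ^ 2) {v : E3}
    (h1 : 0 < inner ℝ vOne v) (i : Fin 3) : -flatForm (2 * ε) v < (l * v i) ^ 2 := by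
  have hcoord := sq_coord_sub_le v i
  rw [flatForm]
  set s := inner ℝ vOne v / √3 with hs
  have hs_pos : 0 < s := by positivity
  have ht : inner ℝ vOne v ^ 2 = 3 * s ^ 2 := by
    rw [hs, div_pow, Real.sq_sqrt (by norm_num)]; ring
  suffices 0 < (l * v i) ^ 2 + 3 / 2 * (v i - s) ^ 2 - 3 * ε ^ 2 * s ^ 2 by
    rw [ht] at hcoord ⊢
    linarith
  have hl : 0 < l ^ 2 + 3 / 2 := by positivity
  refine pos_of_mul_pos_right (a := l ^ 2 + 3 / 2) ?_ hl.le
  calc 0 < ((l ^ 2 + 3 / 2) * (v i - s) + l ^ 2 * s) ^ 2 +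
        3 / 2 * s ^ 2 * ((1 - 2 * ε ^ 2) * l ^ 2 - 3 * ε ^ 2) :=
        add_pos_of_nonneg_of_pos (sq_nonneg _) (mul_pos (by positivity) (by linarith))
    _ = _ := by ring

lemma tubeForm_add_sq (lam : Fin 3 → ℝ) (i : Fin 3) (v : E3) :
    tubeForm lam i v + (lam i * v i) ^ 2 =
      lam i ^ 2 / 3 * ∑ j ∈ Finset.univ.erase i, v j ^ 2 := by
  rw [tubeForm, ← Finset.mul_sum]
  ring

lemma neg_sq_le_tubeForm (lam : Fin 3 → ℝ) (i : Fin 3) (v : E3) :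
    -(lam i * v i) ^ 2 ≤ tubeForm lam i v := by
  have : 0 ≤ lam i ^ 2 / 3 * ∑ j ∈ Finset.univ.erase i, v j ^ 2 := by positivity
  linarith [tubeForm_add_sq lam i v]

lemma coord_eq_zero_of_tubeForm_le {lam : Fin 3 → ℝ} {i : Fin 3} (hlam : 0 < lam i) {v : E3}
    (h : tubeForm lam i v ≤ -(lam i * v i) ^ 2) {j : Fin 3} (hj : j ≠ i) : v j = 0 := by
  have hsum : ∑ k ∈ Finset.univ.erase i, v k ^ 2 ≤ 0 := by
    refine nonpos_of_mul_nonpos_right (a := lam i ^ 2 / 3) ?_ (by positivity)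
    linarith [tubeForm_add_sq lam i v]
  have hj_le : v j ^ 2 ≤ ∑ k ∈ Finset.univ.erase i, v k ^ 2 :=
    Finset.single_le_sum (f := fun k => v k ^ 2) (fun k _ => sq_nonneg _) (by simp [hj])
  exact pow_eq_zero_iff two_ne_zero |>.1 (le_antisymm (hj_le.trans hsum) (sq_nonneg _))

lemma eq_zero_of_tubeForm_nonpos {lam : Fin 3 → ℝ} {i : Fin 3} (hlam : 0 < lam i) {v : E3}
    (h : tubeForm lam i v ≤ 0) (hi : v i = 0) : v = 0 := by
  ext j
  by_cases hj : j = i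
  · rw [hj, hi, PiLp.zero_apply]
  · exact coord_eq_zero_of_tubeForm_le hlam (by simpa [hi] using h) hj

/-! ### Causal vectors -/

namespace LorentzMetric

variable (g : LorentzMetric) {p : T3}

lemma form_add_smul (p : T3) (v w : E3) (s : ℝ) :
    g.form p (v + s • w) (v + s • w) =
      g.form p v v + 2 * s * g.form p v w + s ^ 2 * g.form p w w := by
  simp only [map_add, map_smul, add_apply, smul_apply, smul_eq_mul, g.symm p w v]
  ring

variable {g}

lemma eq_zero_of_forall_form_eq_zero {a : E3} (h : ∀ w, g.form p a w = 0) : a = 0 := by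
  obtain ⟨v, -, hpos⟩ := g.signature p
  by_contra ha
  exact (hpos a ha (by rw [g.symm, h])).ne' (h a)

/-- Otherwise the plane spanned by `u` and `w` is negative semidefinite, although it meets the
positive definite complement of a timelike vector. -/
lemma eq_zero_of_orthogonal_timelike {u w : E3} (hw : g.form p w w < 0)
    (hu : g.form p u u ≤ 0) (huw : g.form p u w = 0) : u = 0 := by
  obtain ⟨v, -, hpos⟩ := g.signature p
  by_contra hu0
  have hvw : g.form p v w ≠ 0 := fun h =>
    (hpos w (by rintro rfl; simp at hw) h).not_gt hw
  set n := g.form p v w • u + (-g.form p v u) • w with hn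
  have hn0 : n = 0 := by
    by_contra hne
    have hn_pos := hpos n hne (by simp [hn]; ring)
    rw [hn, form_add_smul] at hn_pos
    simp only [map_smul, smul_apply, smul_eq_mul, huw] at hn_pos
    nlinarith [mul_nonneg (sq_nonneg (g.form p v w)) (neg_nonneg.2 hu),
      mul_nonneg (sq_nonneg (g.form p v u)) (neg_nonneg.2 hw.le)]
  have hvu : g.form p v u = 0 := by
    have hnw : g.form p n w = 0 := by rw [hn0]; simp
    simp only [hn, map_add, map_smul, add_apply, smul_apply, smul_eq_mul, huw, mul_zero,
      zero_add, mul_eq_zero, neg_eq_zero] at hnw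
    exact hnw.resolve_right hw.ne
  simp [hn, hvu, hvw, hu0] at hn0

end LorentzMetric

/-- The segment from `v₁` to `v` stays in the causal cone, so a zero of `φ` on it would be a causal
vector in the kernel. -/
lemma FutureCausal.pos_of_ker {g : LorentzMetric} {p : T3} {v : E3} (hv : FutureCausal g p v)
    (h1 : g.form p vOne vOne < 0) (φ : E3 →ₗ[ℝ] ℝ) (hφ : 0 < φ vOne)
    (hker : ∀ u, g.form p u u ≤ 0 → φ u = 0 → u = 0) : 0 < φ v := by
  by_contra! hle
  obtain ⟨-, hvv, hv1⟩ := hv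
  set s := -φ v / φ vOne with hs
  have hs0 : 0 ≤ s := div_nonneg (by linarith) hφ.le
  have hzero : v + s • vOne = 0 := by
    refine hker _ ?_ ?_
    · rw [g.form_add_smul]; nlinarith [sq_nonneg s]
    · simp only [map_add, map_smul, smul_eq_mul, hs]; field_simp; ring
  have hvs : v = -s • vOne := by rw [neg_smul]; exact eq_neg_of_add_eq_zero_left hzero
  rw [hvs] at hv1
  simp only [map_smul, smul_apply, smul_eq_mul] at hv1
  nlinarith

namespace IsHedlundMetric

variable {lam : Fin 3 → ℝ} {ε : ℝ} {g : LorentzMetric} (hg : IsHedlundMetric lam ε g)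
include hg

lemma form_vOne_neg (hε : 0 < ε) (p : E3) : g.form (proj p) vOne vOne < 0 := by
  have hflat : flatForm ε vOne < 0 := by
    rw [flatForm_vOne]
    exact neg_neg_of_pos (by positivity)
  exact (hg.lower p vOne hflat.le).trans_lt hflat

lemma tubeForm_le {i : Fin 3} {p : E3} (hp : p ∈ Metric.thickening ε (lineFamily i)) {v : E3}
    (hv : g.form (proj p) v v ≤ 0) : tubeForm lam i v ≤ g.form (proj p) v v := by
  by_cases hpi : p ∈ lineFamily i
  · exact ((hg.upper_on i p hp).1 hpi v).ge
  · rcases eq_or_ne v 0 with rfl | hv0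
    · simp [tubeForm]
    · exact ((hg.upper_on i p hp).2 hpi v hv0 hv).le

lemma coord_pos (hε : 0 < ε) {i : Fin 3} (hlam : 0 < lam i) {p : E3}
    (hp : p ∈ Metric.thickening ε (lineFamily i)) {v : E3} (hv : FutureCausal g (proj p) v) :
    0 < v i := by
  refine hv.pos_of_ker (hg.form_vOne_neg hε p) (EuclideanSpace.proj i : E3 →L[ℝ] ℝ).toLinearMap
    (by simp) fun u hu hi => ?_
  exact eq_zero_of_tubeForm_nonpos hlam ((hg.tubeForm_le hp hu).trans hu) (by simpa using hi)

lemma inner_vOne_pos (hε : 0 < ε) {p : E3}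
    (hp : p ∉ Metric.thickening ε (⋃ i, lineFamily i)) {v : E3}
    (hv : FutureCausal g (proj p) v) : 0 < inner ℝ vOne v := by
  refine hv.pos_of_ker (hg.form_vOne_neg hε p) (innerSL ℝ vOne).toLinearMap ?_ fun u hu hi => ?_
  · simp [norm_vOne]
  · exact eq_zero_of_flatForm_nonpos ((hg.upper_off p hp u hu).trans hu) (by simpa using hi)

/-- If `w` were past pointing, some `w + s • vOne` with `0 ≤ s` would be causal and orthogonal to
`vOne`. -/
lemma futureCausal_of_flatForm (hε : 0 < ε) (p : E3) {w : E3} (hw : flatForm ε w ≤ 0)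
    (h1 : 0 < inner ℝ vOne w) : FutureCausal g (proj p) w := by
  have hvOne := hg.form_vOne_neg hε p
  refine ⟨by rintro rfl; simp at h1, (hg.lower p w hw).trans hw, ?_⟩
  by_contra! hle
  set s := g.form (proj p) w vOne / -g.form (proj p) vOne vOne with hs
  have hs0 : 0 ≤ s := div_nonneg hle (by linarith)
  have hflat : flatForm ε (w + s • vOne) ≤ 0 := by
    rw [flatForm_add_smul_vOne]
    exact sub_nonpos_of_le (hw.trans (by positivity))
  have hzero : w + s • vOne = 0 := by
    refine LorentzMetric.eq_zero_of_orthogonal_timelike hvOne ((hg.lower p _ hflat).trans hflat) ?_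
    simp only [map_add, map_smul, add_apply, smul_apply, smul_eq_mul, hs]
    field_simp [hvOne.ne]
    ring
  have hinner : inner ℝ vOne w + s = 0 := by
    simpa [inner_add_right, inner_smul_right, norm_vOne] using
      congrArg (inner ℝ vOne) hzero
  linarith

end IsHedlundMetric

/-! ### Truncation and the triangle wave -/

/-- The truncation of the real number `t` to the interval `[-r, r]`. -/
def clamp (r t : ℝ) : ℝ := max (-r) (min t r)

lemma abs_clamp_sub_clamp_le (r s t u : ℝ) :
    |clamp r t - clamp s u| ≤ max |r - s| |t - u| := by
  refine (abs_max_sub_max_le_max _ _ _ _).trans (max_le ?_ ?_)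
  · rw [neg_sub_neg, abs_sub_comm]
    exact le_max_left _ _
  · rw [max_comm]
    exact abs_min_sub_min_le_max _ _ _ _

lemma clamp_zero_left (t : ℝ) : clamp 0 t = 0 := by
  simp [clamp]

lemma clamp_eq_self {r t : ℝ} (h : |t| ≤ r) : clamp r t = t := by
  obtain ⟨hl, hr⟩ := abs_le.1 h
  rw [clamp, min_eq_left hr, max_eq_right hl]

lemma norm_coe_le_abs (y : ℝ) : ‖(y : UnitAddCircle)‖ ≤ |y| := by
  rw [UnitAddCircle.norm_eq]
  simpa using round_le y 0

lemma exists_coe_eq_abs_eq_norm (a : UnitAddCircle) :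
    ∃ t : ℝ, (t : UnitAddCircle) = a ∧ |t| = ‖a‖ := by
  induction a using QuotientAddGroup.induction_on with | H y => ?_
  refine ⟨y - round y, ?_, UnitAddCircle.norm_eq.symm⟩
  rw [AddCircle.coe_sub, sub_eq_self, AddCircle.coe_eq_zero_iff]
  exact ⟨round y, by simp⟩

/-- The triangle wave on the circle that is the identity on `[-1/4, 1/4]`. -/
def saw (a : UnitAddCircle) : ℝ := ‖a + ((1 / 4 : ℝ) : UnitAddCircle)‖ - 1 / 4

lemma abs_saw_sub_saw_le (a b : UnitAddCircle) : |saw a - saw b| ≤ ‖a - b‖ := by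
  rw [saw, saw, sub_sub_sub_cancel_right, ← add_sub_add_right_eq_sub a b]
  exact abs_norm_sub_norm_le _ _

lemma saw_coe {t : ℝ} (h : |t| ≤ 1 / 4) : saw t = t := by
  obtain ⟨hl, hr⟩ := abs_le.1 h
  have hnorm : ‖((t + 1 / 4 : ℝ) : UnitAddCircle)‖ = |t + 1 / 4| := by
    rw [AddCircle.norm_coe_eq_abs_iff _ one_ne_zero, abs_of_nonneg (by linarith), abs_one]
    linarith
  rw [saw, ← AddCircle.coe_add, hnorm, abs_of_nonneg (by linarith), add_sub_cancel_right]

lemma abs_saw_le (a : UnitAddCircle) : |saw a| ≤ ‖a‖ := by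
  have hzero : saw 0 = 0 := by simpa using saw_coe (t := 0) (by norm_num)
  simpa [hzero] using abs_saw_sub_saw_le a 0

lemma eventually_saw_add_coe {a : UnitAddCircle} (ha : ‖a‖ < 1 / 4) :
    ∀ᶠ y : ℝ in 𝓝 0, saw (a + y) = saw a + y := by
  obtain ⟨t, rfl, ht⟩ := exists_coe_eq_abs_eq_norm a
  rw [← ht] at ha
  have hcont : Continuous fun y : ℝ => |t + y| := by fun_prop
  filter_upwards [hcont.continuousAt.eventually_lt continuousAt_const
    (by simpa using ha : |t + 0| < 1 / 4)] with y hy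
  rw [← AddCircle.coe_add, saw_coe hy.le, saw_coe ha.le]

/-! ### The calibrating potentials -/

lemma dist_proj_add_le {x v : E3} {r : ℝ} (hr : 0 ≤ r) (h : ∀ j, |v j| ≤ r) :
    dist (proj (x + v)) (proj x) ≤ r := by
  refine (dist_pi_le_iff hr).2 fun j => (le_trans ?_ (h j))
  simpa [dist_eq_norm, proj] using norm_coe_le_abs (v j)

lemma lipschitzWith_proj : LipschitzWith 1 proj :=
  LipschitzWith.of_dist_le_mul fun x y => by
    have h := dist_proj_add_le (x := y) (norm_nonneg (x - y)) fun j => PiLp.norm_apply_le (x - y) j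
    rwa [add_sub_cancel, ← dist_eq_norm, ← one_mul (dist x y)] at h

lemma tendsto_proj_add (x : E3) : Tendsto (fun v => proj (x + v)) (𝓝 0) (𝓝 (proj x)) :=
  Continuous.tendsto' (lipschitzWith_proj.continuous.comp (continuous_const_add x)) _ _ (by simp)

/-- The `j`-th coordinate of a point of the torus relative to the line `l_i`. -/
def relCoord (i j : Fin 3) (p : T3) : UnitAddCircle := p j - (basePt i j : UnitAddCircle)

lemma relCoord_proj_add (i j : Fin 3) (x v : E3) :
    relCoord i j (proj (x + v)) = relCoord i j (proj x) + (v j : UnitAddCircle) := by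
  simp [relCoord, proj, add_sub_right_comm]

lemma norm_relCoord_sub_le_dist (i j : Fin 3) (p q : T3) :
    ‖relCoord i j p - relCoord i j q‖ ≤ dist p q := by
  rw [relCoord, relCoord, sub_sub_sub_cancel_right, ← dist_eq_norm]
  exact dist_le_pi_dist p q j

/-- The distance from the projection of the line `l_i`, in the supremum metric of the torus. -/
def distLine (i : Fin 3) (p : T3) : ℝ := ‖fun j : {j // j ≠ i} => relCoord i j p‖

lemma norm_relCoord_le_distLine {i j : Fin 3} (hj : j ≠ i) (p : T3) :
    ‖relCoord i j p‖ ≤ distLine i p :=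
  norm_le_pi_norm (fun j : {j // j ≠ i} => relCoord i j p) ⟨j, hj⟩

lemma abs_distLine_sub_le_dist (i : Fin 3) (p q : T3) :
    |distLine i p - distLine i q| ≤ dist p q :=
  (abs_norm_sub_norm_le _ _).trans <|
    (pi_norm_le_iff_of_nonneg dist_nonneg).2 fun j => norm_relCoord_sub_le_dist i j p q

lemma continuous_distLine (i : Fin 3) : Continuous (distLine i) :=
  (LipschitzWith.of_dist_le' (K := 1) fun p q => by
    simpa [Real.dist_eq] using abs_distLine_sub_le_dist i p q).continuous

/-- The integer vector `k` as a point of `ℝ³`, that is, as a deck transformation of `proj`. -/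
abbrev intVec (k : Fin 3 → ℤ) : E3 := WithLp.toLp 2 fun j => (k j : ℝ)

lemma proj_add_int (x : E3) (k : Fin 3 → ℤ) :
    proj (x + intVec k) = proj x := by
  funext j
  simp [proj]

lemma line_apply_of_ne {i j : Fin 3} (hj : j ≠ i) (t : ℝ) : line i t j = basePt i j := by
  simp [line, stdE_apply, hj]

lemma distLine_proj_eq_zero {i : Fin 3} {x : E3} (hx : x ∈ lineFamily i) :
    distLine i (proj x) = 0 := by
  obtain ⟨t, k, rfl⟩ := hx
  rw [proj_add_int, distLine, norm_eq_zero]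
  funext ⟨j, hj⟩
  simp [relCoord, proj, line_apply_of_ne hj]

lemma distLine_proj_lt {i : Fin 3} {r : ℝ} {x : E3}
    (hx : x ∈ Metric.thickening r (lineFamily i)) : distLine i (proj x) < r := by
  obtain ⟨y, hy, hxy⟩ := Metric.mem_thickening_iff.1 hx
  calc distLine i (proj x) = |distLine i (proj x) - distLine i (proj y)| := by
        rw [distLine_proj_eq_zero hy, sub_zero, distLine, abs_norm]
    _ ≤ dist (proj x) (proj y) := abs_distLine_sub_le_dist _ _ _
    _ ≤ dist x y := by simpa using lipschitzWith_proj.dist_le_mul x y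
    _ < r := hxy

/-- Two different lines differ by `1 / 2` in the direction orthogonal to both. -/
lemma half_le_distLine_add {i k : Fin 3} (hik : i ≠ k) (p : T3) :
    1 / 2 ≤ distLine i p + distLine k p := by
  have hgap : ∃ j, j ≠ i ∧ j ≠ k ∧ |basePt k j - basePt i j| = 1 / 2 := by
    fin_cases i <;> fin_cases k <;> first
      | exact absurd rfl hik
      | exact ⟨0, by decide, by decide, by simp [basePt]⟩
      | exact ⟨1, by decide, by decide, by simp [basePt]⟩
      | exact ⟨2, by decide, by decide, by simp [basePt]⟩
  obtain ⟨j, hji, hjk, hgap⟩ := hgap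
  have hsub : relCoord i j p - relCoord k j p =
      ((basePt k j - basePt i j : ℝ) : UnitAddCircle) := by
    simp [relCoord]
  have hnorm : ‖((basePt k j - basePt i j : ℝ) : UnitAddCircle)‖ = 1 / 2 := by
    rw [(AddCircle.norm_coe_eq_abs_iff 1 one_ne_zero).2 (by rw [hgap, abs_one]), hgap]
  calc 1 / 2 = ‖relCoord i j p - relCoord k j p‖ := by rw [hsub, hnorm]
    _ ≤ ‖relCoord i j p‖ + ‖relCoord k j p‖ := norm_sub_le _ _
    _ ≤ _ := add_le_add (norm_relCoord_le_distLine hji p) (norm_relCoord_le_distLine hjk p)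

/-- A tent function on the torus, supported in a tube around the projection of `l_i`. -/
def tent (i : Fin 3) (p : T3) : ℝ := max 0 (1 / 5 - distLine i p) / 2

lemma tent_eq_zero {i : Fin 3} {p : T3} (h : 1 / 5 ≤ distLine i p) : tent i p = 0 := by
  rw [tent, max_eq_left (by linarith), zero_div]

lemma abs_tent_sub_tent_le (i : Fin 3) (p q : T3) :
    |tent i p - tent i q| ≤ dist p q / 2 := by
  rw [tent, tent, ← sub_div, abs_div, abs_two]
  gcongr
  refine (abs_max_sub_max_le_max _ _ _ _).trans (max_le (by simp) ?_)
  rw [sub_sub_sub_cancel_left, abs_sub_comm]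
  exact abs_distLine_sub_le_dist _ _ _

/-- The coordinate `x_j` relative to `l_i`, cut off by the tent around `l_i`. -/
def bump (i j : Fin 3) (p : T3) : ℝ := clamp (tent i p) (saw (relCoord i j p))

lemma bump_eq_zero {i : Fin 3} {p : T3} (h : 1 / 5 ≤ distLine i p) (j : Fin 3) :
    bump i j p = 0 := by
  rw [bump, tent_eq_zero h, clamp_zero_left]

lemma bump_eq_saw {i j : Fin 3} (hj : j ≠ i) {p : T3} (h : distLine i p < 1 / 100) :
    bump i j p = saw (relCoord i j p) := by
  refine clamp_eq_self ((abs_saw_le _).trans ?_)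
  have := norm_relCoord_le_distLine hj p
  rw [tent, max_eq_right (by linarith)]
  linarith

lemma abs_bump_sub_bump_le (i j : Fin 3) (p q : T3) :
    |bump i j p - bump i j q| ≤ max (dist p q / 2) ‖relCoord i j p - relCoord i j q‖ :=
  (abs_clamp_sub_clamp_le _ _ _ _).trans <|
    max_le_max (abs_tent_sub_tent_le i p q) (abs_saw_sub_saw_le _ _)

/-- The function on the torus by which the coordinate `x_j` is corrected. -/
def correction (j : Fin 3) (p : T3) : ℝ := ∑ i ∈ Finset.univ.erase j, bump i j p

/-- The `j`-th coordinate, corrected to be locally constant near the lines `L_i` with `i ≠ j`. -/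
def potential (j : Fin 3) (x : E3) : ℝ := x j - correction j (proj x)

lemma lipschitzWith_correction (j : Fin 3) : LipschitzWith 2 (correction j) := by
  refine LipschitzWith.of_dist_le_mul fun p q => ?_
  have hbump (i : Fin 3) : |bump i j p - bump i j q| ≤ dist p q :=
    (abs_bump_sub_bump_le i j p q).trans <|
      max_le (half_le_self dist_nonneg) (norm_relCoord_sub_le_dist i j p q)
  calc |correction j p - correction j q|
      ≤ ∑ i ∈ Finset.univ.erase j, |bump i j p - bump i j q| := by
        rw [correction, correction, ← Finset.sum_sub_distrib]
        exact Finset.abs_sum_le_sum_abs _ _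
    _ ≤ (Finset.univ.erase j).card • dist p q := Finset.sum_le_card_nsmul _ _ _ fun i _ => hbump i
    _ = 2 * dist p q := by simp

lemma exists_abs_correction_le : ∃ C, ∀ j p, |correction j p| ≤ C := by
  have hbdd (j : Fin 3) : ∃ C, ∀ p, |correction j p| ≤ C := by
    obtain ⟨C, hC⟩ := isCompact_univ.exists_bound_of_continuousOn
      (lipschitzWith_correction j).continuous.continuousOn
    exact ⟨C, fun p => hC p (mem_univ p)⟩
  choose C hC using hbdd
  obtain ⟨D, hD⟩ := (finite_range C).bddAbove
  exact ⟨D, fun j p => (hC j p).trans (hD ⟨j, rfl⟩)⟩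

lemma exists_abs_potential_sub_le : ∃ C, ∀ j x y,
    |potential j y - potential j x - (y - x) j| ≤ C := by
  obtain ⟨C, hC⟩ := exists_abs_correction_le
  refine ⟨C + C, fun j x y => ?_⟩
  calc |potential j y - potential j x - (y - x) j|
      = |correction j (proj x) - correction j (proj y)| := by
        simp only [potential, PiLp.sub_apply]; ring_nf
    _ ≤ C + C := (abs_sub _ _).trans (add_le_add (hC _ _) (hC _ _))

lemma lipschitzWith_potential (j : Fin 3) : LipschitzWith 3 (potential j) := by
  have hcoord : LipschitzWith 1 fun x : E3 => x j :=
    LipschitzWith.of_dist_le_mul fun x y => by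
      simpa [dist_eq_norm] using PiLp.norm_apply_le (x - y) j
  have h := hcoord.sub ((lipschitzWith_correction j).comp lipschitzWith_proj)
  rwa [show (1 + 2 * 1 : NNReal) = 3 by norm_num] at h

lemma eventually_correction_eq {i : Fin 3} {p : T3} (h : ∀ k ≠ i, 1 / 5 < distLine k p) :
    ∀ᶠ q in 𝓝 p, ∀ j, correction j q = if j = i then 0 else bump i j q := by
  have hfar : ∀ᶠ q in 𝓝 p, ∀ k ≠ i, 1 / 5 < distLine k q := by
    simp only [eventually_all]
    exact fun k hk =>
      continuousAt_const.eventually_lt (continuous_distLine k).continuousAt (h k hk)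
  filter_upwards [hfar] with q hq j
  have hsum : ∀ k ∈ Finset.univ.erase j, k ≠ i → bump k j q = 0 := fun k _ hk =>
    bump_eq_zero (hq k hk).le j
  split_ifs with hji
  · subst hji
    exact Finset.sum_eq_zero fun k hk => hsum k hk (Finset.ne_of_mem_erase hk)
  · exact Finset.sum_eq_single i hsum (by simp [Ne.symm hji])

lemma exists_forall_lt_distLine (p : T3) : ∃ i, ∀ k ≠ i, 1 / 5 < distLine k p := by
  by_cases h : ∃ i, distLine i p < 1 / 4
  · obtain ⟨i, hi⟩ := h
    exact ⟨i, fun k hk => by linarith [half_le_distLine_add hk p]⟩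
  · push Not at h
    exact ⟨0, fun k _ => by linarith [h k]⟩

lemma eventually_potential_add_of_distLine_lt {i : Fin 3} {x : E3}
    (h : distLine i (proj x) < 1 / 100) :
    ∀ᶠ v : E3 in 𝓝 0, ∀ j, potential j (x + v) = potential j x + if j = i then v i else 0 := by
  have hcorr := eventually_correction_eq (i := i) (p := proj x) fun k hk => by
    linarith [half_le_distLine_add hk (proj x)]
  have hsaw : ∀ᶠ v : E3 in 𝓝 0, ∀ j ≠ i,
      saw (relCoord i j (proj x) + (v j : UnitAddCircle)) = saw (relCoord i j (proj x)) + v j := by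
    simp only [eventually_all]
    intro j hj
    have hcoord : Tendsto (fun v : E3 => v j) (𝓝 0) (𝓝 0) :=
      Continuous.tendsto' (by fun_prop) _ _ rfl
    refine hcoord.eventually (eventually_saw_add_coe ?_)
    linarith [norm_relCoord_le_distLine hj (proj x)]
  have hclose : ∀ᶠ v : E3 in 𝓝 0, distLine i (proj (x + v)) < 1 / 100 :=
    ((continuous_distLine i).tendsto _ |>.comp (tendsto_proj_add x)).eventually_lt_const h
  filter_upwards [(tendsto_proj_add x).eventually hcorr, hsaw, hclose] with v hv hsaw hclose j
  rw [potential, potential, hv, hcorr.self_of_nhds]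
  split_ifs with hj
  · subst hj; simp
  · rw [bump_eq_saw hj hclose, bump_eq_saw hj h, relCoord_proj_add, hsaw j hj, PiLp.add_apply]
    ring

lemma abs_bump_add_sub_le {v : E3} (hv : ∀ j k, v k ≤ 2 * v j) (i j : Fin 3) (x : E3) :
    |bump i j (proj (x + v)) - bump i j (proj x)| ≤ v j := by
  have hv0 (k : Fin 3) : 0 ≤ v k := by linarith [hv k k]
  refine (abs_bump_sub_bump_le _ _ _ _).trans (max_le ?_ ?_)
  · have := dist_proj_add_le (x := x) (mul_nonneg zero_le_two (hv0 j)) fun k => by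
      rw [abs_of_nonneg (hv0 k)]; exact hv j k
    linarith
  · rw [relCoord_proj_add, add_sub_cancel_left]
    exact (norm_coe_le_abs _).trans_eq (abs_of_nonneg (hv0 j))

lemma exists_eventually_le_potential_add (x : E3) : ∃ i, ∀ᶠ v : E3 in 𝓝 0,
    (∀ j k, v k ≤ 2 * v j) →
      ∀ j, potential j x + (if j = i then v i else 0) ≤ potential j (x + v) := by
  obtain ⟨i, hi⟩ := exists_forall_lt_distLine (proj x)
  have hcorr := eventually_correction_eq hi
  refine ⟨i, ?_⟩
  filter_upwards [(tendsto_proj_add x).eventually hcorr] with v hcorr_v hv j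
  rw [potential, potential, hcorr_v, hcorr.self_of_nhds, PiLp.add_apply]
  split_ifs with hj
  · subst hj; linarith
  · linarith [abs_le.1 (abs_bump_add_sub_le hv i j x)]

/-- The index `i` *calibrates* the vector `v` at `x`: the corrected coordinate `x_i` grows at least
as fast as `x_i` in the direction `v`, the other corrected coordinates do not decrease, and
`lam i * v i` bounds the Lorentzian length of `v`, with equality only along the line `l_i`. -/
structure IsCalibratingIndex (lam : Fin 3 → ℝ) (g : LorentzMetric) (x v : E3) (i : Fin 3) :
    Prop where
  coord_pos : 0 < v i
  sqrt_le : √(-g.form (proj x) v v) ≤ lam i * v i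
  mem_of_eq : √(-g.form (proj x) v v) = lam i * v i → x ∈ lineFamily i
  coord_eq_zero_of_eq : √(-g.form (proj x) v v) = lam i * v i → ∀ j ≠ i, v j = 0
  le_potential : ∀ j, ∀ᶠ h in 𝓝[>] (0 : ℝ),
    h * (if j = i then v i else 0) ≤ potential j (x + h • v) - potential j x

/-- The corrected coordinates calibrate the metric: every future pointing causal vector has a
calibrating index. -/
def Calibrated (lam : Fin 3 → ℝ) (g : LorentzMetric) : Prop :=
  ∀ x v : E3, FutureCausal g (proj x) v → ∃ i, IsCalibratingIndex lam g x v i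

lemma tendsto_smul_nhdsGT_zero (v : E3) : Tendsto (fun h : ℝ => h • v) (𝓝[>] 0) (𝓝 0) :=
  (Continuous.tendsto' (by fun_prop) 0 0 (zero_smul ℝ v)).mono_left nhdsWithin_le_nhds

namespace IsHedlundMetric

variable {lam : Fin 3 → ℝ} {ε : ℝ} {g : LorentzMetric} {x v : E3}

lemma isCalibratingIndex_of_mem_tube (hg : IsHedlundMetric lam ε g) (hε : 0 < ε)
    (hε' : ε < 1 / 100) {i : Fin 3} (hlam : 0 < lam i)
    (hx : x ∈ Metric.thickening ε (lineFamily i)) (hv : FutureCausal g (proj x) v) :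
    IsCalibratingIndex lam g x v i := by
  have hvi := hg.coord_pos hε hlam hx hv
  have hlv : 0 ≤ lam i * v i := by positivity
  have htube := hg.tubeForm_le hx hv.2.1
  have hform_of_eq (h : √(-g.form (proj x) v v) = lam i * v i) :
      g.form (proj x) v v = -(lam i * v i) ^ 2 := by
    rw [← h, Real.sq_sqrt (neg_nonneg.2 hv.2.1), neg_neg]
  refine ⟨hvi, ?_, fun h => ?_, fun h j hj => ?_, fun j => ?_⟩
  · exact Real.sqrt_le_iff.2 ⟨hlv, by linarith [neg_sq_le_tubeForm lam i v]⟩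
  · by_contra hmem
    have hlt : tubeForm lam i v < g.form (proj x) v v :=
      (hg.upper_on i x hx).2 hmem v hv.1 hv.2.1
    linarith [neg_sq_le_tubeForm lam i v, hform_of_eq h]
  · exact coord_eq_zero_of_tubeForm_le hlam (htube.trans_eq (hform_of_eq h)) hj
  · filter_upwards [(tendsto_smul_nhdsGT_zero v).eventually <|
      eventually_potential_add_of_distLine_lt ((distLine_proj_lt hx).trans hε')] with h hh
    rw [hh j, add_sub_cancel_left, mul_ite, mul_zero, PiLp.smul_apply, smul_eq_mul]

lemma exists_isCalibratingIndex_of_notMem_tube (hg : IsHedlundMetric lam ε g)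
    (hlam : ∀ i, 0 < lam i) (hε : 0 < ε) (hε' : ε < 1 / 100)
    (hsmall : ∀ i, 3 * ε ^ 2 < (1 - 2 * ε ^ 2) * lam i ^ 2)
    (hx : x ∉ Metric.thickening ε (⋃ i, lineFamily i)) (hv : FutureCausal g (proj x) v) :
    ∃ i, IsCalibratingIndex lam g x v i := by
  have hv1 := hg.inner_vOne_pos hε hx hv
  have hflat : flatForm (2 * ε) v ≤ g.form (proj x) v v := hg.upper_off x hx v hv.2.1
  have hcone := coord_le_two_mul_of_flatForm hε hε' (hflat.trans hv.2.1) hv1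
  have hpos (j : Fin 3) : 0 < v j := by
    refine lt_of_le_of_ne (by linarith [hcone j j]) fun hj => hv.1 ?_
    ext k
    exact le_antisymm (by simpa [← hj] using hcone j k) (show 0 ≤ v k by linarith [hcone k k])
  obtain ⟨i, hi⟩ := exists_eventually_le_potential_add x
  have hlt : √(-g.form (proj x) v v) < lam i * v i := by
    rw [Real.sqrt_lt' (mul_pos (hlam i) (hpos i))]
    linarith [neg_flatForm_lt_sq (hsmall i) hv1 i]
  refine ⟨i, hpos i, hlt.le, fun h => absurd h hlt.ne, fun h => absurd h hlt.ne, fun j => ?_⟩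
  filter_upwards [(tendsto_smul_nhdsGT_zero v).eventually hi, self_mem_nhdsWithin] with h hh hpos
  have hcone_h (j k : Fin 3) : (h • v) k ≤ 2 * (h • v) j := by
    have := mul_le_mul_of_nonneg_left (hcone j k) (le_of_lt hpos)
    simp only [PiLp.smul_apply, smul_eq_mul]
    linarith
  have := hh hcone_h j
  rw [mul_ite, mul_zero]
  simpa [le_sub_iff_add_le'] using this

lemma calibrated (hg : IsHedlundMetric lam ε g) (hlam : ∀ i, 0 < lam i) (hε : 0 < ε)
    (hε' : ε < 1 / 100) (hsmall : ∀ i, 3 * ε ^ 2 < (1 - 2 * ε ^ 2) * lam i ^ 2) :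
    Calibrated lam g := by
  intro x v hv
  by_cases hx : x ∈ Metric.thickening ε (⋃ i, lineFamily i)
  · rw [Metric.thickening_iUnion, mem_iUnion] at hx
    obtain ⟨i, hi⟩ := hx
    exact ⟨i, hg.isCalibratingIndex_of_mem_tube hε hε' (hlam i) hi hv⟩
  · exact hg.exists_isCalibratingIndex_of_notMem_tube hlam hε hε' hsmall hx hv

end IsHedlundMetric

variable {g : LorentzMetric} {lam : Fin 3 → ℝ} {ε : ℝ}

/-! ### Potentials along future pointing curves -/

lemma le_deriv_comp_of_eventually_le {E : Type*} [NormedAddCommGroup E] [NormedSpace ℝ E]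
    {V : E → ℝ} {K : NNReal} (hV : LipschitzWith K V) {γ : ℝ → E} {t c d : ℝ} {v : E}
    (hγ : HasDerivAt γ v t) (hd : HasDerivAt (fun s => V (γ s)) d t)
    (h : ∀ᶠ h in 𝓝[>] (0 : ℝ), h * c ≤ V (γ t + h • v) - V (γ t)) : c ≤ d := by
  have hslope : Tendsto (fun h : ℝ => c - K * ‖h⁻¹ • (γ (t + h) - γ t) - v‖) (𝓝[>] 0) (𝓝 c) := by
    simpa using ((hγ.tendsto_slope_zero_right.sub_const v).norm.const_mul (K : ℝ)).const_sub c
  refine le_of_tendsto_of_tendsto hslope hd.tendsto_slope_zero_right ?_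
  filter_upwards [h, self_mem_nhdsWithin] with s hs hpos
  have hpos : 0 < s := hpos
  have hdefect : γ (t + s) - (γ t + s • v) = s • (s⁻¹ • (γ (t + s) - γ t) - v) := by
    rw [smul_sub, smul_inv_smul₀ hpos.ne', sub_sub]
  have hLip := hV.dist_le_mul (γ (t + s)) (γ t + s • v)
  rw [dist_eq_norm (γ (t + s)), hdefect, norm_smul, Real.norm_of_nonneg hpos.le,
    Real.dist_eq] at hLip
  rw [smul_eq_mul, le_inv_mul_iff₀ hpos]
  linarith [(abs_le.1 hLip).1]

section Curves

variable {γ : ℝ → E3} {a b : ℝ}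

lemma IsCalibratingIndex.le_deriv_potential {t : ℝ} {i : Fin 3}
    (hi : IsCalibratingIndex lam g (γ t) (deriv γ t) i) (hγ : DifferentiableAt ℝ γ t) {j : Fin 3}
    (hj : DifferentiableAt ℝ (fun s => potential j (γ s)) t) :
    (if j = i then deriv γ t i else 0) ≤ deriv (fun s => potential j (γ s)) t :=
  le_deriv_comp_of_eventually_le (lipschitzWith_potential j) hγ.hasDerivAt hj.hasDerivAt
    (hi.le_potential j)

/-- The density of the Lorentzian length, for causal curves. -/
def speed (g : LorentzMetric) (γ : ℝ → E3) (t : ℝ) : ℝ :=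
  √(-g.form (proj (γ t)) (deriv γ t) (deriv γ t))

/-- The derivative along `γ` of the corrected linear form `∑ lam j * x j`. -/
def potentialRate (lam : Fin 3 → ℝ) (γ : ℝ → E3) (t : ℝ) : ℝ :=
  ∑ j, lam j * deriv (fun s => potential j (γ s)) t

namespace IsFuturePointing

lemma lorentzLength_eq (h : IsFuturePointing g γ a b) :
    lorentzLength g γ a b = ∫ t in a..b, speed g γ t := by
  refine intervalIntegral.integral_congr_ae_restrict ?_
  rw [uIoc_of_le h.1.le]
  filter_upwards [ae_restrict_of_ae_restrict_of_subset Ioc_subset_Icc_self h.2.2] with t ht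
  rw [LorentzMetric.lift, abs_of_nonpos ht.2.2.1, speed]

lemma absolutelyContinuous_potential (h : IsFuturePointing g γ a b) (j : Fin 3) :
    AbsolutelyContinuousOnInterval (fun s => potential j (γ s)) a b := by
  obtain ⟨K, hK⟩ := h.2.1
  refine LipschitzOnWith.absolutelyContinuousOnInterval (K := 3 * K) ?_
  rw [uIcc_of_le h.1.le]
  exact (lipschitzWith_potential j).comp_lipschitzOnWith hK

lemma integral_deriv_potential (h : IsFuturePointing g γ a b) (j : Fin 3) :
    ∫ t in a..b, deriv (fun s => potential j (γ s)) t = potential j (γ b) - potential j (γ a) :=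
  (h.absolutelyContinuous_potential j).integral_deriv_eq_sub

lemma intervalIntegrable_potentialRate (h : IsFuturePointing g γ a b) (lam : Fin 3 → ℝ) :
    IntervalIntegrable (potentialRate lam γ) volume a b := by
  have h := IntervalIntegrable.sum Finset.univ fun j _ =>
    (h.absolutelyContinuous_potential j).intervalIntegrable_deriv.const_mul (lam j)
  exact h.congr fun t _ => by simp [potentialRate]

lemma integral_potentialRate (h : IsFuturePointing g γ a b) (lam : Fin 3 → ℝ) :
    ∫ t in a..b, potentialRate lam γ t =
      ∑ j, lam j * (potential j (γ b) - potential j (γ a)) := by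
  simp only [potentialRate]
  rw [intervalIntegral.integral_finsetSum fun j _ =>
    (h.absolutelyContinuous_potential j).intervalIntegrable_deriv.const_mul _]
  simp only [intervalIntegral.integral_const_mul, h.integral_deriv_potential]

lemma ae_differentiableAt_potential (h : IsFuturePointing g γ a b) :
    ∀ᵐ t ∂(volume.restrict (Icc a b)), ∀ j, DifferentiableAt ℝ (fun s => potential j (γ s)) t := by
  refine ae_all_iff.2 fun j => (ae_restrict_iff' measurableSet_Icc).2 ?_
  simpa only [uIcc_of_le h.1.le] using (h.absolutelyContinuous_potential j).ae_differentiableAt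

end IsFuturePointing

namespace Calibrated

variable (hcal : Calibrated lam g)
include hcal

lemma ae_exists_index (h : IsFuturePointing g γ a b) :
    ∀ᵐ t ∂(volume.restrict (Icc a b)), ∃ i, IsCalibratingIndex lam g (γ t) (deriv γ t) i ∧
      ∀ j, (if j = i then deriv γ t i else 0) ≤ deriv (fun s => potential j (γ s)) t := by
  filter_upwards [h.2.2, h.ae_differentiableAt_potential] with t ht hd
  obtain ⟨i, hi⟩ := hcal _ _ ht.2
  exact ⟨i, hi, fun j => hi.le_deriv_potential ht.1 (hd j)⟩

lemma potential_le_potential (h : IsFuturePointing g γ a b) (j : Fin 3) :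
    potential j (γ a) ≤ potential j (γ b) := by
  rw [← sub_nonneg, ← h.integral_deriv_potential]
  refine intervalIntegral.integral_nonneg_of_ae_restrict h.1.le ?_
  filter_upwards [hcal.ae_exists_index h] with t ht
  obtain ⟨i, hi, hle⟩ := ht
  refine le_trans ?_ (hle j)
  split_ifs
  exacts [hi.coord_pos.le, le_rfl]

lemma ae_exists_index_le_potentialRate (hlam : ∀ i, 0 ≤ lam i) (h : IsFuturePointing g γ a b) :
    ∀ᵐ t ∂(volume.restrict (Icc a b)), ∃ i, IsCalibratingIndex lam g (γ t) (deriv γ t) i ∧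
      lam i * deriv γ t i ≤ potentialRate lam γ t := by
  filter_upwards [hcal.ae_exists_index h] with t ht
  obtain ⟨i, hi, hle⟩ := ht
  refine ⟨i, hi, ?_⟩
  calc lam i * deriv γ t i = ∑ j, lam j * (if j = i then deriv γ t i else 0) := by simp
    _ ≤ potentialRate lam γ t :=
      Finset.sum_le_sum fun j _ => mul_le_mul_of_nonneg_left (hle j) (hlam j)

lemma ae_speed_le (hlam : ∀ i, 0 ≤ lam i) (h : IsFuturePointing g γ a b) :
    ∀ᵐ t ∂(volume.restrict (Icc a b)), speed g γ t ≤ potentialRate lam γ t := by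
  filter_upwards [hcal.ae_exists_index_le_potentialRate hlam h] with t ⟨i, hi, hle⟩
  exact hi.sqrt_le.trans hle

lemma lorentzLength_le (hlam : ∀ i, 0 ≤ lam i) (h : IsFuturePointing g γ a b) :
    lorentzLength g γ a b ≤ ∑ j, lam j * (potential j (γ b) - potential j (γ a)) := by
  rw [h.lorentzLength_eq, ← h.integral_potentialRate, intervalIntegral.integral_of_le h.1.le,
    intervalIntegral.integral_of_le h.1.le]
  exact integral_mono_of_nonneg (Eventually.of_forall fun t => Real.sqrt_nonneg _)
    (h.intervalIntegrable_potentialRate lam).1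
    (ae_restrict_of_ae_restrict_of_subset Ioc_subset_Icc_self (hcal.ae_speed_le hlam h))

lemma ae_mem_lineFamily_of_length_eq (hlam : ∀ i, 0 ≤ lam i) (h : IsFuturePointing g γ a b)
    (hint : IntervalIntegrable (speed g γ) volume a b)
    (heq : ∫ t in a..b, speed g γ t = ∑ j, lam j * (potential j (γ b) - potential j (γ a))) :
    ∀ᵐ t ∂(volume.restrict (Icc a b)),
      ∃ i, γ t ∈ lineFamily i ∧ 0 < deriv γ t i ∧ ∀ j ≠ i, deriv γ t j = 0 := by
  have hrate := h.intervalIntegrable_potentialRate lam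
  have hzero : ∫ t in Icc a b, (potentialRate lam γ t - speed g γ t) = 0 := by
    rw [integral_Icc_eq_integral_Ioc, ← intervalIntegral.integral_of_le h.1.le,
      intervalIntegral.integral_sub hrate hint, heq, h.integral_potentialRate, sub_self]
  have hnonneg : 0 ≤ᵐ[volume.restrict (Icc a b)] fun t => potentialRate lam γ t - speed g γ t := by
    filter_upwards [hcal.ae_speed_le hlam h] with t ht using sub_nonneg.2 ht
  rw [integral_eq_zero_iff_of_nonneg_ae hnonneg
    ((intervalIntegrable_iff_integrableOn_Icc_of_le h.1.le).1 (hrate.sub hint))] at hzero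
  filter_upwards [hcal.ae_exists_index_le_potentialRate hlam h, hzero] with t ⟨i, hi, hle⟩ hz
  have hspeed : √(-g.form (proj (γ t)) (deriv γ t) (deriv γ t)) = lam i * deriv γ t i :=
    hi.sqrt_le.antisymm (hle.trans_eq (sub_eq_zero.1 hz))
  exact ⟨i, hi.mem_of_eq hspeed, hi.coord_pos, hi.coord_eq_zero_of_eq hspeed⟩

lemma exists_lorentzLength_le (hlam : ∀ i, 0 ≤ lam i) : ∃ C, ∀ γ a b, IsFuturePointing g γ a b →
    lorentzLength g γ a b ≤ ∑ i, lam i * (γ b - γ a) i + C := by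
  obtain ⟨C, hC⟩ := exists_abs_potential_sub_le
  refine ⟨∑ i, lam i * C, fun γ a b h => (hcal.lorentzLength_le hlam h).trans ?_⟩
  rw [← Finset.sum_add_distrib]
  simp only [← mul_add]
  gcongr with i
  · exact hlam i
  · linarith [abs_le.1 (hC i (γ a) (γ b))]

lemma exists_displacement_ge : ∃ C, ∀ γ a b, IsFuturePointing g γ a b →
    ∀ j, -C ≤ (γ b - γ a) j := by
  obtain ⟨C, hC⟩ := exists_abs_potential_sub_le
  refine ⟨C, fun γ a b h j => ?_⟩
  linarith [abs_le.1 (hC j (γ a) (γ b)), hcal.potential_le_potential h j]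

end Calibrated

end Curves

/-! ### Concatenation of Lipschitz curves -/

section Concatenation

variable {E : Type*}

section Metric

variable {γ δ : ℝ → E} {a b c : ℝ} {K : NNReal}

lemma piecewise_Iic_eqOn_Ici (h : γ b = δ b) : EqOn ((Iic b).piecewise γ δ) δ (Ici b) := by
  intro t ht
  rcases (mem_Ici.1 ht).eq_or_lt with rfl | ht
  · rw [piecewise_eq_of_mem _ _ _ self_mem_Iic, h]
  · exact piecewise_eq_of_notMem _ _ _ (notMem_Iic.2 ht)

lemma piecewise_Iic_eventuallyEq_of_lt {t : ℝ} (ht : t < b) :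
    (Iic b).piecewise γ δ =ᶠ[𝓝 t] γ :=
  ((piecewise_eqOn _ γ δ).mono Iio_subset_Iic_self).eventuallyEq_of_mem (Iio_mem_nhds ht)

lemma piecewise_Iic_eventuallyEq_of_gt {t : ℝ} (ht : b < t) :
    (Iic b).piecewise γ δ =ᶠ[𝓝 t] δ :=
  ((piecewise_eqOn_compl _ γ δ).mono fun _ => notMem_Iic.2).eventuallyEq_of_mem (Ioi_mem_nhds ht)

variable [PseudoMetricSpace E]

lemma lipschitzOnWith_Icc_of_Icc (hab : LipschitzOnWith K γ (Icc a b))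
    (hbc : LipschitzOnWith K γ (Icc b c)) : LipschitzOnWith K γ (Icc a c) := by
  have hle (s : ℝ) (hs : s ∈ Icc a c) (t : ℝ) (ht : t ∈ Icc a c) (hst : s ≤ t) :
      dist (γ s) (γ t) ≤ K * dist s t := by
    rcases le_total t b with htb | hbt
    · exact hab.dist_le_mul s ⟨hs.1, hst.trans htb⟩ t ⟨ht.1, htb⟩
    rcases le_total b s with hbs | hsb
    · exact hbc.dist_le_mul s ⟨hbs, hs.2⟩ t ⟨hbt, ht.2⟩
    calc dist (γ s) (γ t) ≤ dist (γ s) (γ b) + dist (γ b) (γ t) := dist_triangle _ _ _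
      _ ≤ K * dist s b + K * dist b t :=
        add_le_add (hab.dist_le_mul s ⟨hs.1, hsb⟩ b ⟨hs.1.trans hsb, le_rfl⟩)
          (hbc.dist_le_mul b ⟨le_rfl, hbt.trans ht.2⟩ t ⟨hbt, ht.2⟩)
      _ = K * dist s t := by
        rw [← mul_add, dist_add_dist_of_mem_segment (segment_eq_Icc hst ▸ ⟨hsb, hbt⟩)]
  refine LipschitzOnWith.of_dist_le_mul fun s hs t ht => ?_
  rcases le_total s t with hst | hst
  · exact hle s hs t ht hst
  · rw [dist_comm, dist_comm s]
    exact hle t ht s hs hst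

lemma lipschitzOnWith_piecewise_Iic {K' : NNReal} (hγ : LipschitzOnWith K γ (Icc a b))
    (hδ : LipschitzOnWith K' δ (Icc b c)) (h : γ b = δ b) :
    LipschitzOnWith (max K K') ((Iic b).piecewise γ δ) (Icc a c) := by
  refine lipschitzOnWith_Icc_of_Icc (b := b) ?_ ?_
  · intro s hs t ht
    rw [piecewise_eq_of_mem _ _ _ (mem_Iic.2 hs.2), piecewise_eq_of_mem _ _ _ (mem_Iic.2 ht.2)]
    exact hγ.weaken (le_max_left _ _) hs ht
  · intro s hs t ht
    rw [piecewise_Iic_eqOn_Ici h hs.1, piecewise_Iic_eqOn_Ici h ht.1]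
    exact hδ.weaken (le_max_right _ _) hs ht

end Metric

variable [NormedAddCommGroup E] [NormedSpace ℝ E] [FiniteDimensional ℝ E] {F : E × E → ℝ}
  {γ δ : ℝ → E} {a b c : ℝ} {K K' : NNReal}

lemma intervalIntegrable_comp_deriv (hF : Continuous F) (hab : a ≤ b)
    (hγ : LipschitzOnWith K γ (Icc a b)) :
    IntervalIntegrable (fun t => F (γ t, deriv γ t)) volume a b := by
  borelize E
  have := FiniteDimensional.proper ℝ E
  obtain ⟨C, hC⟩ := ((isCompact_Icc.image_of_continuousOn hγ.continuousOn).prod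
    (isCompact_closedBall (0 : E) K)).exists_bound_of_continuousOn hF.continuousOn
  rw [intervalIntegrable_iff_integrableOn_Ioo_of_le hab]
  refine IntegrableOn.of_bound measure_Ioo_lt_top ?_ C ?_
  · exact hF.comp_aestronglyMeasurable <|
      ((hγ.continuousOn.mono Ioo_subset_Icc_self).aestronglyMeasurable measurableSet_Ioo).prodMk
      (stronglyMeasurable_deriv γ).aestronglyMeasurable
  · filter_upwards [ae_restrict_mem measurableSet_Ioo] with t ht
    refine hC _ ⟨mem_image_of_mem γ (Ioo_subset_Icc_self ht), mem_closedBall_zero_iff.2 ?_⟩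
    exact norm_deriv_le_of_lipschitzOn (Icc_mem_nhds ht.1 ht.2) hγ

lemma integral_comp_deriv_piecewise_Iic (hF : Continuous F) (hab : a ≤ b) (hbc : b ≤ c)
    (hγ : LipschitzOnWith K γ (Icc a b)) (hδ : LipschitzOnWith K' δ (Icc b c)) (h : γ b = δ b) :
    ∫ t in a..c, F ((Iic b).piecewise γ δ t, deriv ((Iic b).piecewise γ δ) t) =
      (∫ t in a..b, F (γ t, deriv γ t)) + ∫ t in b..c, F (δ t, deriv δ t) := by
  have hσ := lipschitzOnWith_piecewise_Iic hγ hδ h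
  rw [← intervalIntegral.integral_add_adjacent_intervals
    (intervalIntegrable_comp_deriv hF hab (hσ.mono (Icc_subset_Icc_right hbc)))
    (intervalIntegrable_comp_deriv hF hbc (hσ.mono (Icc_subset_Icc_left hab)))]
  congr 1 <;> refine intervalIntegral.integral_congr_uIoo fun t ht => ?_
  · rw [uIoo_of_le hab] at ht
    have heq := piecewise_Iic_eventuallyEq_of_lt (γ := γ) (δ := δ) ht.2
    simp only [heq.eq_of_nhds, heq.deriv_eq]
  · rw [uIoo_of_le hbc] at ht
    have heq := piecewise_Iic_eventuallyEq_of_gt (γ := γ) (δ := δ) ht.1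
    simp only [heq.eq_of_nhds, heq.deriv_eq]

end Concatenation

/-! ### Polygonal future pointing curves -/

section Polygonal

variable {γ δ : ℝ → E3} {a b c : ℝ}

lemma LorentzMetric.continuous_lift (g : LorentzMetric) : Continuous g.lift := g.smooth.continuous

lemma LorentzMetric.continuous_lengthDensity (g : LorentzMetric) :
    Continuous fun z : E3 × E3 => √|g.lift z.1 z.2 z.2| := by
  have := g.continuous_lift
  fun_prop

lemma IsFuturePointing.piecewise_Iic (hγ : IsFuturePointing g γ a b)
    (hδ : IsFuturePointing g δ b c) (h : γ b = δ b) :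
    IsFuturePointing g ((Iic b).piecewise γ δ) a c := by
  obtain ⟨hab, ⟨K, hK⟩, hγ⟩ := hγ
  obtain ⟨hbc, ⟨K', hK'⟩, hδ⟩ := hδ
  refine ⟨hab.trans hbc, ⟨_, lipschitzOnWith_piecewise_Iic hK hK' h⟩, ?_⟩
  rw [ae_restrict_iff' measurableSet_Icc] at hγ hδ ⊢
  filter_upwards [hγ, hδ, Measure.ae_ne volume b] with t hγt hδt hne ht
  rcases lt_or_gt_of_ne hne with hlt | hgt
  · have heq := piecewise_Iic_eventuallyEq_of_lt (γ := γ) (δ := δ) hlt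
    rw [heq.differentiableAt_iff, heq.eq_of_nhds, heq.deriv_eq]
    exact hγt ⟨ht.1, hlt.le⟩
  · have heq := piecewise_Iic_eventuallyEq_of_gt (γ := γ) (δ := δ) hgt
    rw [heq.differentiableAt_iff, heq.eq_of_nhds, heq.deriv_eq]
    exact hδt ⟨hgt.le, ht.2⟩

/-- There is a future pointing curve from `x` to `y` of Lorentzian length at least `ℓ` and
Euclidean length `R`. The starting time is arbitrary, so that such curves can be concatenated
without reparametrization. -/
def Reach (g : LorentzMetric) (x y : E3) (ℓ R : ℝ) : Prop :=
  ∀ a, ∃ (γ : ℝ → E3) (b : ℝ), IsFuturePointing g γ a b ∧ γ a = x ∧ γ b = y ∧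
    ℓ ≤ lorentzLength g γ a b ∧ riemLength γ a b = R

lemma Reach.mono {x y : E3} {ℓ ℓ' R : ℝ} (h : Reach g x y ℓ R) (hℓ : ℓ' ≤ ℓ) :
    Reach g x y ℓ' R := fun a =>
  let ⟨γ, b, hγ, ha, hb, hlen, hR⟩ := h a
  ⟨γ, b, hγ, ha, hb, hℓ.trans hlen, hR⟩

lemma Reach.trans {x y z : E3} {ℓ ℓ' R R' : ℝ} (hxy : Reach g x y ℓ R) (hyz : Reach g y z ℓ' R') :
    Reach g x z (ℓ + ℓ') (R + R') := by
  intro a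
  obtain ⟨γ, b, hγ, rfl, rfl, hℓ, rfl⟩ := hxy a
  obtain ⟨δ, c, hδ, hb, rfl, hℓ', rfl⟩ := hyz b
  obtain ⟨K, hK⟩ := hγ.2.1
  obtain ⟨K', hK'⟩ := hδ.2.1
  refine ⟨(Iic b).piecewise γ δ, c, hγ.piecewise_Iic hδ hb.symm,
    piecewise_eq_of_mem _ _ _ hγ.1.le, piecewise_Iic_eqOn_Ici hb.symm hδ.1.le,
    (add_le_add hℓ hℓ').trans_eq ?_, ?_⟩
  · exact (integral_comp_deriv_piecewise_Iic (F := fun z => √|g.lift z.1 z.2 z.2|)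
      g.continuous_lengthDensity hγ.1.le hδ.1.le hK hK' hb.symm).symm
  · exact integral_comp_deriv_piecewise_Iic (F := fun z => ‖z.2‖) continuous_snd.norm
      hγ.1.le hδ.1.le hK hK' hb.symm

lemma hasDerivAt_add_sub_smul {E : Type*} [NormedAddCommGroup E] [NormedSpace ℝ E] (x w : E)
    (a t : ℝ) : HasDerivAt (fun t : ℝ => x + (t - a) • w) w t := by
  simpa using (((hasDerivAt_id t).sub_const a).smul_const w).const_add x

lemma reach_segment {x w : E3} {ℓ : ℝ} (hw : ∀ s : ℝ, FutureCausal g (proj (x + s • w)) w)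
    (hℓ : ∀ s : ℝ, ℓ ≤ √|g.lift (x + s • w) w w|) : Reach g x (x + w) ℓ ‖w‖ := by
  intro a
  have hderiv (t : ℝ) := hasDerivAt_add_sub_smul x w a t
  have hLip : LipschitzWith ‖w‖₊ fun t : ℝ => x + (t - a) • w :=
    lipschitzWith_of_nnnorm_deriv_le (fun t => (hderiv t).differentiableAt)
      fun t => (congrArg nnnorm (hderiv t).deriv).le
  refine ⟨fun t => x + (t - a) • w, a + 1, ⟨lt_add_one a, ⟨_, hLip.lipschitzOnWith⟩,
    Eventually.of_forall fun t => ⟨(hderiv t).differentiableAt, ?_⟩⟩, by simp, by simp, ?_, ?_⟩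
  · rw [(hderiv t).deriv]
    exact hw _
  · have hint := intervalIntegrable_comp_deriv g.continuous_lengthDensity (lt_add_one a).le
      hLip.lipschitzOnWith
    simp only [(hderiv _).deriv] at hint
    have := intervalIntegral.integral_mono (lt_add_one a).le intervalIntegrable_const hint
      fun t => hℓ (t - a)
    simpa [lorentzLength, (hderiv _).deriv] using this
  · simp [riemLength, (hderiv _).deriv]

end Polygonal

lemma FutureCausal.smul {p : T3} {v : E3} (h : FutureCausal g p v) {c : ℝ} (hc : 0 < c) :
    FutureCausal g p (c • v) := by
  obtain ⟨hv, hvv, hv1⟩ := h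
  refine ⟨smul_ne_zero hc.ne' hv, ?_, ?_⟩ <;>
    simp only [map_smul, smul_apply, smul_eq_mul]
  · exact mul_nonpos_of_nonneg_of_nonpos hc.le (mul_nonpos_of_nonneg_of_nonpos hc.le hvv)
  · exact mul_neg_of_pos_of_neg hc hv1

lemma norm_stdE (i : Fin 3) : ‖stdE i‖ = 1 := by simp [stdE]

lemma sum_smul_stdE (v : E3) : ∑ j, v j • stdE j = v := by
  ext k
  simp [stdE_apply]

lemma norm_le_sum_abs (v : E3) : ‖v‖ ≤ ∑ j, |v j| := by
  simpa only [sum_smul_stdE, norm_smul, norm_stdE, mul_one, Real.norm_eq_abs] using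
    norm_sum_le Finset.univ fun j => v j • stdE j

lemma tubeForm_stdE (lam : Fin 3 → ℝ) (i : Fin 3) : tubeForm lam i (stdE i) = -lam i ^ 2 := by
  have hsum : ∑ j ∈ Finset.univ.erase i, stdE i j ^ 2 = 0 :=
    Finset.sum_eq_zero fun j hj => by simp [stdE_apply, Finset.ne_of_mem_erase hj]
  have h := tubeForm_add_sq lam i (stdE i)
  rw [hsum, stdE_apply, if_pos rfl] at h
  linarith

lemma exists_mem_lineFamily_norm_sub_le (i : Fin 3) (x : E3) :
    ∃ p ∈ lineFamily i, ‖p - x‖ ≤ 3 := by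
  refine ⟨basePt i + WithLp.toLp 2 fun j => (⌊x j⌋ : ℝ), ⟨0, fun j => ⌊x j⌋, by simp [line]⟩,
    (norm_le_sum_abs _).trans ?_⟩
  have hbase (j : Fin 3) : 0 ≤ basePt i j ∧ basePt i j ≤ 1 := by
    fin_cases i <;> fin_cases j <;> simp [basePt] <;> norm_num
  calc ∑ j, |(basePt i + WithLp.toLp 2 (fun j => (⌊x j⌋ : ℝ)) - x) j| ≤ ∑ _j : Fin 3, (1 : ℝ) :=
        Finset.sum_le_sum fun j _ => by
          simp only [PiLp.sub_apply, PiLp.add_apply]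
          rw [abs_le]
          constructor <;> linarith [hbase j, Int.floor_le (x j), Int.lt_floor_add_one (x j)]
    _ = 3 := by simp

lemma add_smul_mem_lineFamily {i : Fin 3} {x : E3} (hx : x ∈ lineFamily i) (s : ℝ) :
    x + s • stdE i ∈ lineFamily i := by
  obtain ⟨t, k, rfl⟩ := hx
  exact ⟨t + s, k, by simp only [line, add_smul]; abel⟩

lemma flatForm_add_smul_vOne_nonpos (hε : 0 < ε) {u : E3} {s : ℝ}
    (hs : ‖u‖ * (2 + 2 / ε) ≤ s) : flatForm ε (u + s • vOne) ≤ 0 := by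
  have hinner : -‖u‖ ≤ inner ℝ vOne u := by
    have := abs_real_inner_le_norm vOne u
    rw [norm_vOne, one_mul] at this
    exact (abs_le.1 this).1
  have hflat : flatForm ε u ≤ ‖u‖ ^ 2 := by
    rw [flatForm]
    nlinarith [sq_nonneg (inner ℝ vOne u : ℝ), sq_nonneg (ε * inner ℝ vOne u)]
  have hgain : 2 * ‖u‖ / ε ≤ 2 * inner ℝ vOne u + s :=
    calc 2 * ‖u‖ / ε = ‖u‖ * (2 + 2 / ε) - 2 * ‖u‖ := by ring
      _ ≤ 2 * inner ℝ vOne u + s := by linarith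
  have hs' : 2 * ‖u‖ / ε ≤ s := by
    refine le_trans ?_ hs
    linarith [norm_nonneg u, show ‖u‖ * (2 + 2 / ε) = 2 * ‖u‖ + 2 * ‖u‖ / ε by ring]
  have hs0 : 0 ≤ s := le_trans (by positivity) hs'
  rw [flatForm_add_smul_vOne, sub_nonpos]
  calc flatForm ε u ≤ ‖u‖ ^ 2 := hflat
    _ = ε ^ 2 / 4 * (2 * ‖u‖ / ε * (2 * ‖u‖ / ε)) := by field_simp; ring
    _ ≤ ε ^ 2 / 4 * (s * (2 * inner ℝ vOne u + s)) := by gcongr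

namespace IsHedlundMetric

variable (hg : IsHedlundMetric lam ε g) (hε : 0 < ε)
include hg hε

lemma form_eq_tubeForm {i : Fin 3} {x : E3} (hx : x ∈ lineFamily i) (v : E3) :
    g.form (proj x) v v = tubeForm lam i v :=
  (hg.upper_on i x (Metric.self_subset_thickening hε _ hx)).1 hx v

lemma form_stdE {i : Fin 3} {x : E3} (hx : x ∈ lineFamily i) :
    g.form (proj x) (stdE i) (stdE i) = -lam i ^ 2 := by
  rw [hg.form_eq_tubeForm hε hx, tubeForm_stdE]

lemma futureCausal_stdE {i : Fin 3} (hlam : 0 < lam i) {x : E3} (hx : x ∈ lineFamily i) :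
    FutureCausal g (proj x) (stdE i) := by
  have hform := hg.form_stdE hε hx
  refine ⟨fun h => by simpa [h] using norm_stdE i, by rw [hform]; nlinarith, ?_⟩
  have hsum := g.form_add_smul (proj x) (stdE i) vOne 1
  have h1 := tubeForm_add_sq lam i vOne
  have h2 := tubeForm_add_sq lam i (stdE i + (1 : ℝ) • vOne)
  have hperp : ∑ j ∈ Finset.univ.erase i, (stdE i + (1 : ℝ) • vOne) j ^ 2 =
      ∑ j ∈ Finset.univ.erase i, vOne j ^ 2 :=
    Finset.sum_congr rfl fun j hj => by simp [stdE_apply, Finset.ne_of_mem_erase hj]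
  rw [hform, hg.form_eq_tubeForm hε hx, hg.form_eq_tubeForm hε hx] at hsum
  rw [hperp] at h2
  simp only [PiLp.add_apply, PiLp.smul_apply, stdE_apply, vOne_apply, if_true, smul_eq_mul,
    one_mul] at h1 h2
  rw [show g.form (proj x) (stdE i) vOne = -(lam i ^ 2 * (1 / √3)) by
    linear_combination (h2 - h1 - hsum) / 2]
  exact neg_neg_of_pos (by positivity)

lemma reach_smul_stdE {i : Fin 3} (hlam : 0 < lam i) {x : E3} (hx : x ∈ lineFamily i) {m : ℝ}
    (hm : 0 < m) : Reach g x (x + m • stdE i) (lam i * m) m := by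
  have hmem (s : ℝ) : x + s • m • stdE i ∈ lineFamily i := by
    rw [smul_smul]
    exact add_smul_mem_lineFamily hx _
  have hnorm : ‖m • stdE i‖ = m := by rw [norm_smul, norm_stdE, mul_one, Real.norm_of_nonneg hm.le]
  have h : Reach g x (x + m • stdE i) (lam i * m) ‖m • stdE i‖ := by
    refine reach_segment (fun s => (hg.futureCausal_stdE hε hlam (hmem s)).smul hm)
      fun s => Real.le_sqrt_of_sq_le ?_
    rw [LorentzMetric.lift]
    simp only [map_smul, smul_apply, smul_eq_mul, hg.form_stdE hε (hmem s)]
    rw [show m * (m * -lam i ^ 2) = -(lam i * m) ^ 2 by ring, abs_neg]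
    exact le_abs_self _
  rwa [hnorm] at h

lemma reach_of_norm_sub_le {x y : E3} {r s : ℝ} (hr : 0 < r)
    (hs : r * (2 + 2 / ε) ≤ s) (h : ‖y - x - s • vOne‖ ≤ r) : Reach g x y 0 ‖y - x‖ := by
  set u := y - x - s • vOne
  have hu : y - x = u + s • vOne := (sub_add_cancel _ _).symm
  have hflat : flatForm ε (y - x) ≤ 0 :=
    hu ▸ flatForm_add_smul_vOne_nonpos hε ((mul_le_mul_of_nonneg_right h (by positivity)).trans hs)
  have hfuture : 0 < inner ℝ vOne (y - x) := by
    have hinner := (abs_le.1 (abs_real_inner_le_norm vOne u)).1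
    have : 0 < r * (2 / ε) := by positivity
    rw [norm_vOne, one_mul] at hinner
    rw [hu, inner_add_right, inner_smul_right, inner_vOne_self]
    linarith
  simpa using reach_segment (x := x) (fun s => hg.futureCausal_of_flatForm hε _ hflat hfuture)
    fun s => Real.sqrt_nonneg _

lemma exists_reach_leg {i : Fin 3} (hlam : 0 < lam i) {s : ℝ} (hs : 3 * (2 + 2 / ε) ≤ s) (x : E3)
    {m : ℝ} (hm : 0 < m) : ∃ y R, Reach g x y (lam i * m) R ∧ |R - m| ≤ s + 3 ∧
      ‖y - x - s • vOne - m • stdE i‖ ≤ 3 := by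
  obtain ⟨p, hp, hpx⟩ := exists_mem_lineFamily_norm_sub_le i (x + s • vOne)
  rw [← sub_sub] at hpx
  have hreach := (hg.reach_of_norm_sub_le hε three_pos hs hpx).trans
    (hg.reach_smul_stdE hε hlam hp hm)
  rw [zero_add] at hreach
  have hs0 : 0 ≤ s := le_trans (by positivity) hs
  refine ⟨_, _, hreach, ?_, by convert hpx using 2; abel⟩
  rw [add_sub_cancel_right, abs_norm]
  calc ‖p - x‖ ≤ ‖s • vOne‖ + ‖p - x - s • vOne‖ := norm_le_insert' _ _
    _ ≤ s + 3 := by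
      rw [norm_smul, norm_vOne, mul_one, Real.norm_of_nonneg hs0]
      exact add_le_add_right hpx s

end IsHedlundMetric

lemma IsHedlundMetric.exists_reach_legs (hg : IsHedlundMetric lam ε g) (hε : 0 < ε)
    (hlam : ∀ i, 0 < lam i) {s : ℝ} (hs : 9 * (2 + 2 / ε) ≤ s) (x : E3) {m : E3}
    (hm : ∀ j, 0 < m j) :
    ∃ R, Reach g x (x + m + (4 * s) • vOne) (∑ j, lam j * m j) R ∧
      |R - ∑ j, m j| ≤ 4 * (s + 9) := by
  have hs3 : 3 * (2 + 2 / ε) ≤ s := by linarith [show 0 < 2 / ε by positivity]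
  obtain ⟨y₀, R₀, h₀, hR₀, hy₀⟩ := hg.exists_reach_leg hε (hlam 0) hs3 x (hm 0)
  obtain ⟨y₁, R₁, h₁, hR₁, hy₁⟩ := hg.exists_reach_leg hε (hlam 1) hs3 y₀ (hm 1)
  obtain ⟨y₂, R₂, h₂, hR₂, hy₂⟩ := hg.exists_reach_leg hε (hlam 2) hs3 y₁ (hm 2)
  set z := x + m + (4 * s) • vOne with hz
  have hrest : ‖z - y₂ - s • vOne‖ ≤ 9 := by
    have hsplit : z - y₂ - s • vOne = -((y₀ - x - s • vOne - m 0 • stdE 0) +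
        (y₁ - y₀ - s • vOne - m 1 • stdE 1) + (y₂ - y₁ - s • vOne - m 2 • stdE 2)) := by
      have hsum := sum_smul_stdE m
      rw [Fin.sum_univ_three] at hsum
      linear_combination (norm := module) hz - hsum
    rw [hsplit, norm_neg]
    linarith [norm_add₃_le (a := y₀ - x - s • vOne - m 0 • stdE 0)
      (b := y₁ - y₀ - s • vOne - m 1 • stdE 1) (c := y₂ - y₁ - s • vOne - m 2 • stdE 2)]
  have hnorm : ‖z - y₂‖ ≤ s + 9 := by
    have hs0 : 0 ≤ s := le_trans (by positivity) hs3
    have := norm_le_insert' (z - y₂) (s • vOne)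
    rw [norm_smul, norm_vOne, mul_one, Real.norm_of_nonneg hs0] at this
    linarith
  refine ⟨R₀ + R₁ + R₂ + ‖z - y₂‖, ?_, ?_⟩
  · simpa [Fin.sum_univ_three] using
      ((h₀.trans h₁).trans h₂).trans (hg.reach_of_norm_sub_le hε (by norm_num) hs hrest)
  · rw [Fin.sum_univ_three]
    rw [abs_le] at hR₀ hR₁ hR₂ ⊢
    constructor <;> linarith [norm_nonneg (z - y₂)]

lemma IsHedlundMetric.exists_reach (hg : IsHedlundMetric lam ε g) (hε : 0 < ε)
    (hlam : ∀ i, 0 < lam i) : ∃ C, 0 ≤ C ∧ ∀ x y : E3, (∀ j, C ≤ (y - x) j) →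
      ∃ R, Reach g x y (∑ j, lam j * (y - x) j - C) R ∧ |R - ∑ j, (y - x) j| ≤ C := by
  set s := 9 * (2 + 2 / ε)
  set q := 4 * s * (1 / √3)
  have hs : 0 ≤ s := by positivity
  have hq : 0 ≤ q := by positivity
  have hlamq : 0 ≤ (∑ j, lam j) * q := mul_nonneg (Finset.sum_nonneg fun j _ => (hlam j).le) hq
  refine ⟨(∑ j, lam j) * q + 3 * q + 4 * (s + 9), by positivity, fun x y hxy => ?_⟩
  set m := y - x - (4 * s) • vOne with hm
  have hmj (j : Fin 3) : m j = (y - x) j - q := by simp [hm, q]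
  obtain ⟨R, hreach, hR⟩ := hg.exists_reach_legs hε hlam le_rfl x (m := m) fun j => by
    linarith [hxy j, hmj j]
  have hlen : ∑ j, lam j * m j = ∑ j, lam j * (y - x) j - (∑ j, lam j) * q := by
    simp only [hmj, mul_sub, Finset.sum_sub_distrib, Finset.sum_mul]
  have hsum : ∑ j, m j = ∑ j, (y - x) j - 3 * q := by
    simp [hmj, Finset.sum_sub_distrib]
  have hend : x + m + (4 * s) • vOne = y := by
    rw [hm]
    abel
  rw [hend, hlen] at hreach
  refine ⟨R, hreach.mono (by linarith), ?_⟩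
  rw [hsum] at hR
  rw [abs_le] at hR ⊢
  constructor <;> linarith

/-! ### The stable time cone -/

/-- The closed positive octant. -/
def octant : Set E3 := {h | ∀ j, 0 ≤ h j}

lemma stdE_mem_octant (i : Fin 3) : stdE i ∈ octant := fun j => by
  rw [stdE_apply]
  split_ifs <;> norm_num

lemma hull_stdE_eq_octant :
    (PointedCone.hull ℝ {stdE 0, stdE 1, stdE 2} : Set E3) = octant := by
  refine Subset.antisymm (fun h hh => ?_) fun h hh => ?_
  · induction hh using Submodule.span_induction with
    | mem x hx => rcases hx with rfl | rfl | rfl <;> exact stdE_mem_octant _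
    | zero => exact fun j => le_rfl
    | add x y _ _ hx hy => exact fun j => add_nonneg (hx j) (hy j)
    | smul c x _ hx => exact fun j => mul_nonneg c.2 (hx j)
  · rw [SetLike.mem_coe, ← sum_smul_stdE h]
    refine sum_mem fun j _ => Submodule.smul_mem _ (⟨h j, hh j⟩ : {c : ℝ // 0 ≤ c})
      (Submodule.subset_span ?_)
    fin_cases j <;> simp

lemma isClosed_octant : IsClosed octant := by
  simp only [octant, ofPred_forall]
  exact isClosed_iInter fun j => isClosed_le continuous_const (by fun_prop)

lemma convex_octant : Convex ℝ octant := by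
  rw [← hull_stdE_eq_octant]
  exact PointedCone.convex _

lemma mem_interior_octant {h : E3} : h ∈ interior octant ↔ ∀ j, 0 < h j := by
  refine ⟨fun hh j => ?_, fun hh => ?_⟩
  · have hlim : Tendsto (fun s : ℝ => h + s • stdE j) (𝓝[<] 0) (𝓝 h) :=
      (Continuous.tendsto' (by fun_prop) _ _ (by simp)).mono_left nhdsWithin_le_nhds
    obtain ⟨s, hs, hs0⟩ := ((hlim.eventually (mem_interior_iff_mem_nhds.1 hh)).and
      self_mem_nhdsWithin).exists
    have : 0 ≤ h j + s := by simpa [stdE_apply] using hs j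
    linarith
  · refine mem_interior.2 ⟨{h | ∀ j, 0 < h j}, fun x hx j => (hx j).le, ?_, hh⟩
    simp only [ofPred_forall]
    exact isOpen_iInter_of_finite fun j => isOpen_lt continuous_const (by fun_prop)

lemma mem_frontier_octant {h : E3} (hh : h ∈ octant) : h ∈ frontier octant ↔ ∃ j, h j ≤ 0 := by
  rw [isClosed_octant.frontier_eq, Set.mem_sdiff, mem_interior_octant]
  simp [hh]

lemma infDist_frontier_octant_le {h : E3} (hh : h ∈ octant) (j : Fin 3) :
    Metric.infDist h (frontier octant) ≤ h j := by
  have hoct : h - h j • stdE j ∈ octant := fun k => by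
    simp only [PiLp.sub_apply, PiLp.smul_apply, stdE_apply, smul_eq_mul]
    split_ifs with hk
    · simp [hk]
    · simpa using hh k
  have hmem : h - h j • stdE j ∈ frontier octant :=
    (mem_frontier_octant hoct).2 ⟨j, by simp [stdE_apply]⟩
  refine (Metric.infDist_le_dist_of_mem hmem).trans_eq ?_
  rw [dist_eq_norm, sub_sub_cancel, norm_smul, norm_stdE, mul_one, Real.norm_of_nonneg (hh j)]

lemma abs_coord_le_norm (h : E3) (j : Fin 3) : |h j| ≤ ‖h‖ := PiLp.norm_apply_le h j

lemma le_infDist_frontier_octant {h : E3} {c : ℝ} (hh : ∀ j, c ≤ h j) :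
    c ≤ Metric.infDist h (frontier octant) := by
  have hzero : (0 : E3) ∈ frontier octant :=
    (mem_frontier_octant fun j => le_rfl).2 ⟨0, le_rfl⟩
  refine (Metric.le_infDist ⟨0, hzero⟩).2 fun q hq => ?_
  obtain ⟨j, hj⟩ := (mem_frontier_octant (isClosed_octant.frontier_subset hq)).1 hq
  rw [dist_eq_norm]
  calc c ≤ h j - q j := by linarith [hh j]
    _ ≤ ‖h - q‖ := (le_abs_self _).trans (abs_coord_le_norm (h - q) j)

lemma Calibrated.stableTimeConeOne_subset (hcal : Calibrated lam g) :
    stableTimeConeOne g ⊆ octant := by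
  rintro h ⟨γ, a, b, hγ, hR, hcl⟩ j
  obtain ⟨C, hC⟩ := hcal.exists_displacement_ge
  set R := fun n => riemLength (γ n) (a n) (b n)
  have hlim : Tendsto (fun n => (R n)⁻¹ * -C) atTop (𝓝 0) := by
    simpa using hR.inv_tendsto_atTop.mul_const (-C)
  have hclj : MapClusterPt (h j) atTop fun n => ((R n)⁻¹ • (γ n (b n) - γ n (a n))) j :=
    hcl.continuousAt_comp (f := fun x : E3 => x j) (by fun_prop)
  by_contra! hneg
  have hfreq := hclj.frequently (Iio_mem_nhds (show h j < h j / 2 by linarith))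
  have hev := hlim.eventually_const_lt (show h j / 2 < 0 by linarith)
  obtain ⟨n, hlt, hgt, hRn⟩ := (hfreq.and_eventually (hev.and (hR.eventually_gt_atTop 0))).exists
  have hdisp := mul_le_mul_of_nonneg_left (hC _ _ _ (hγ n) j) (inv_pos.2 hRn).le
  have hlt : (R n)⁻¹ * (γ n (b n) - γ n (a n)) j < h j / 2 := hlt
  exact absurd (hgt.trans_le hdisp) hlt.not_gt

lemma tendsto_inv_mul_of_abs_sub_le {r s : ℕ → ℝ} {C : ℝ} (hs : Tendsto s atTop atTop)
    (h : ∀ n, |s n - r n| ≤ C) : Tendsto (fun n => (s n)⁻¹ * r n) atTop (𝓝 1) := by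
  have hsmall : Tendsto (fun n => (s n)⁻¹ * (s n - r n)) atTop (𝓝 0) :=
    hs.inv_tendsto_atTop.zero_mul_isBoundedUnder_le ⟨C, eventually_map.2 (Eventually.of_forall h)⟩
  have hlim : Tendsto (fun n => 1 - (s n)⁻¹ * (s n - r n)) atTop (𝓝 1) := by
    simpa using hsmall.const_sub 1
  refine hlim.congr' ?_
  filter_upwards [hs.eventually_gt_atTop 0] with n hn
  rw [mul_sub, inv_mul_cancel₀ hn.ne', sub_sub_cancel]

namespace IsHedlundMetric

variable (hg : IsHedlundMetric lam ε g) (hε : 0 < ε) (hlam : ∀ i, 0 < lam i)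
include hg hε hlam

lemma exists_curve_displacement : ∃ (C : ℝ) (c : E3), ∀ h ∈ octant, ∃ (γ : ℝ → E3) (a b : ℝ),
    IsFuturePointing g γ a b ∧ γ b - γ a = h + c ∧ |riemLength γ a b - ∑ j, h j| ≤ C := by
  obtain ⟨C, hC0, hC⟩ := hg.exists_reach hε hlam
  set c : E3 := WithLp.toLp 2 fun _ => C
  refine ⟨4 * C, c, fun h hh => ?_⟩
  obtain ⟨R, hreach, hR⟩ := hC 0 (h + c) fun j => by simpa [c] using hh j
  obtain ⟨γ, b, hγ, ha, hb, -, rfl⟩ := hreach 0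
  refine ⟨γ, 0, b, hγ, by rw [ha, hb, sub_zero], ?_⟩
  have hsum : ∑ j, (h + c - 0) j = ∑ j, h j + 3 * C := by simp [c, Finset.sum_add_distrib]
  rw [hsum] at hR
  rw [abs_le] at hR ⊢
  constructor <;> linarith

lemma mem_stableTimeConeOne {h : E3} (hh : h ∈ octant) (hsum : ∑ j, h j = 1) :
    h ∈ stableTimeConeOne g := by
  obtain ⟨C, c, hC⟩ := hg.exists_curve_displacement hε hlam
  choose γ a b hγ hdisp hlen using fun n : ℕ =>
    hC ((n : ℝ) • h) fun j => mul_nonneg n.cast_nonneg (hh j)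
  set R := fun n => riemLength (γ n) (a n) (b n)
  have hbound (n : ℕ) : |R n - n| ≤ C := by
    simpa [← Finset.mul_sum, hsum] using hlen n
  have hR : Tendsto R atTop atTop :=
    tendsto_atTop_mono (fun n => by linarith [(abs_le.1 (hbound n)).1])
      (tendsto_atTop_add_const_right _ (-C) tendsto_natCast_atTop_atTop)
  have hlim : Tendsto (fun n : ℕ => ((R n)⁻¹ * n) • h + (R n)⁻¹ • c) atTop (𝓝 h) := by
    simpa using ((tendsto_inv_mul_of_abs_sub_le hR hbound).smul_const h).add
      (hR.inv_tendsto_atTop.smul_const c)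
  refine ⟨γ, a, b, hγ, hR, (hlim.congr fun n => ?_).mapClusterPt⟩
  rw [hdisp, smul_add, ← smul_smul]

lemma stableTimeCone_eq (hcal : Calibrated lam g) : stableTimeCone g = octant := by
  refine Subset.antisymm ?_ fun h hh => ?_
  · rintro _ ⟨c, hc, k, hk, rfl⟩ j
    exact mul_nonneg hc (hcal.stableTimeConeOne_subset hk j)
  · have hnonneg : 0 ≤ ∑ j, h j := Finset.sum_nonneg fun j _ => hh j
    rcases hnonneg.eq_or_lt with hzero | hpos
    · refine ⟨0, le_rfl, stdE 0, hg.mem_stableTimeConeOne hε hlam (stdE_mem_octant 0) ?_, ?_⟩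
      · simp [stdE_apply]
      · have := norm_le_sum_abs h
        simpa only [abs_of_nonneg (hh _), ← hzero, norm_le_zero_iff, zero_smul] using this
    · refine ⟨∑ j, h j, hpos.le, (∑ j, h j)⁻¹ • h, hg.mem_stableTimeConeOne hε hlam ?_ ?_, ?_⟩
      · exact fun j => mul_nonneg (inv_pos.2 hpos).le (hh j)
      · simp only [PiLp.smul_apply, smul_eq_mul, ← Finset.mul_sum, inv_mul_cancel₀ hpos.ne']
      · rw [smul_inv_smul₀ hpos.ne']

end IsHedlundMetric

/-! ### The stable time separation -/

lemma Reach.le_timeSep {x y : E3} {ℓ R : ℝ} (h : Reach g x y ℓ R) :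
    ENNReal.ofReal ℓ ≤ timeSep g x y := by
  obtain ⟨γ, b, hγ, hx, hy, hℓ, -⟩ := h 0
  exact (ENNReal.ofReal_le_ofReal hℓ).trans
    (le_iSup_of_le γ (le_iSup_of_le 0 (le_iSup_of_le b (le_iSup_of_le ⟨hγ, hx, hy⟩ le_rfl))))

lemma Calibrated.exists_timeSep_le (hcal : Calibrated lam g) (hlam : ∀ i, 0 ≤ lam i) :
    ∃ C, ∀ x y : E3, timeSep g x y ≤ ENNReal.ofReal (∑ i, lam i * (y - x) i + C) := by
  obtain ⟨C, hC⟩ := hcal.exists_lorentzLength_le hlam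
  refine ⟨C, fun x y => iSup_le fun γ => iSup_le fun a => iSup_le fun b => iSup_le ?_⟩
  rintro ⟨hγ, rfl, rfl⟩
  exact ENNReal.ofReal_le_ofReal (hC γ a b hγ)

lemma norm_le_div_of_mem_innerCone {h : E3} {δ : ℝ} (hδ : 0 < δ) (hh : h ∈ innerCone octant δ)
    (j : Fin 3) : ‖h‖ ≤ h j / δ := by
  rw [le_div_iff₀' hδ]
  exact hh.2.trans (infDist_frontier_octant_le hh.1 j)

lemma IsHedlundMetric.exists_abs_sub_timeSep_le (hg : IsHedlundMetric lam ε g) (hε : 0 < ε)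
    (hlam : ∀ i, 0 < lam i) (hcal : Calibrated lam g) {δ : ℝ} (hδ : 0 < δ) :
    ∃ C : ℝ, ∀ x y : E3, y - x ∈ innerCone octant δ →
      timeSep g x y ≠ ⊤ ∧ |∑ i, lam i * (y - x) i - (timeSep g x y).toReal| ≤ C := by
  obtain ⟨C₁, hC₁⟩ := hcal.exists_timeSep_le fun i => (hlam i).le
  obtain ⟨C₂, hC₂0, hC₂⟩ := hg.exists_reach hε hlam
  set M := (∑ i, lam i) * (C₂ / δ)
  have hM : 0 ≤ M :=
    mul_nonneg (Finset.sum_nonneg fun j _ => (hlam j).le) (by positivity)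
  refine ⟨|C₁| + C₂ + M, fun x y hxy => ?_⟩
  have htop : timeSep g x y ≠ ⊤ := ne_top_of_le_ne_top ENNReal.ofReal_ne_top (hC₁ x y)
  have hlin : 0 ≤ ∑ i, lam i * (y - x) i :=
    Finset.sum_nonneg fun j _ => mul_nonneg (hlam j).le (hxy.1 j)
  have hupper : (timeSep g x y).toReal ≤ ∑ i, lam i * (y - x) i + |C₁| :=
    ENNReal.toReal_le_of_le_ofReal (by positivity)
      ((hC₁ x y).trans (ENNReal.ofReal_le_ofReal (by gcongr; exact le_abs_self C₁)))
  have hlower : ∑ i, lam i * (y - x) i ≤ (timeSep g x y).toReal + C₂ + M := by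
    by_cases hbig : ∀ j, C₂ ≤ (y - x) j
    · obtain ⟨R, hR, -⟩ := hC₂ x y hbig
      linarith [(ENNReal.ofReal_le_iff_le_toReal htop).1 hR.le_timeSep]
    · push Not at hbig
      obtain ⟨j, hj⟩ := hbig
      have hnorm : ‖y - x‖ ≤ C₂ / δ :=
        (norm_le_div_of_mem_innerCone hδ hxy j).trans (by gcongr)
      have hle : ∑ i, lam i * (y - x) i ≤ M := by
        simp only [M, Finset.sum_mul]
        exact Finset.sum_le_sum fun i _ => mul_le_mul_of_nonneg_left
          (((le_abs_self _).trans (abs_coord_le_norm _ i)).trans hnorm) (hlam i).le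
      linarith [ENNReal.toReal_nonneg (a := timeSep g x y)]
  refine ⟨htop, abs_le.2 ⟨?_, ?_⟩⟩ <;> linarith [abs_nonneg C₁]

lemma sum_mul_add (lam : Fin 3 → ℝ) (h k : E3) :
    ∑ i, lam i * (h + k) i = ∑ i, lam i * h i + ∑ i, lam i * k i := by
  simp [mul_add, Finset.sum_add_distrib]

lemma sum_mul_smul (lam : Fin 3 → ℝ) (c : ℝ) (h : E3) :
    ∑ i, lam i * (c • h) i = c * ∑ i, lam i * h i := by
  simp [Finset.mul_sum, mul_left_comm]

lemma IsHedlundMetric.isStableTimeSeparation_of_eq (hg : IsHedlundMetric lam ε g) (hε : 0 < ε)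
    (hlam : ∀ i, 0 < lam i) (hcal : Calibrated lam g) {l : E3 → ℝ}
    (hl : ∀ h ∈ octant, l h = ∑ i, lam i * h i) : IsStableTimeSeparation g l := by
  have hsmul {c : ℝ} (hc : 0 ≤ c) {h : E3} (hh : h ∈ octant) : l (c • h) = c * l h := by
    rw [hl h hh, hl _ fun j => mul_nonneg hc (hh j), sum_mul_smul]
  have hadd {h k : E3} (hh : h ∈ octant) (hk : k ∈ octant) : l (h + k) = l h + l k := by
    rw [hl h hh, hl k hk, hl _ fun j => add_nonneg (hh j) (hk j), sum_mul_add]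
  constructor <;> rw [hg.stableTimeCone_eq hε hlam hcal]
  · refine ⟨convex_octant, fun x hx y hy a b ha hb _ => ?_⟩
    rw [hadd (fun j => mul_nonneg ha (hx j)) (fun j => mul_nonneg hb (hy j)), hsmul ha hx,
      hsmul hb hy, smul_eq_mul, smul_eq_mul]
  · intro δ hδ
    obtain ⟨C, hC⟩ := hg.exists_abs_sub_timeSep_le hε hlam hcal hδ
    refine ⟨C, fun x y hxy => ?_⟩
    rw [hl _ hxy.1]
    exact hC x y hxy
  · exact fun c hc h hh => hsmul hc hh
  · exact fun h hh k hk => (hadd hk hh).ge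
  · intro h _ hh
    have hne : (𝓝[octant] h).NeBot := mem_closure_iff_nhdsWithin_neBot.1 (subset_closure hh)
    have hcont : ContinuousWithinAt l octant h :=
      ContinuousWithinAt.congr (f := fun h : E3 => ∑ i, lam i * h i)
        (Continuous.continuousWithinAt (by fun_prop)) hl (hl h hh)
    exact ((continuous_coe_real_ereal.tendsto _).comp hcont).limsup_eq.symm

lemma IsHedlundMetric.eq_of_isStableTimeSeparation_of_pos (hg : IsHedlundMetric lam ε g)
    (hε : 0 < ε) (hlam : ∀ i, 0 < lam i) (hcal : Calibrated lam g) {l : E3 → ℝ}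
    (hl : IsStableTimeSeparation g l) {h : E3} (hpos : ∀ j, 0 < h j) :
    l h = ∑ i, lam i * h i := by
  have hT := hg.stableTimeCone_eq hε hlam hcal
  have hoct : h ∈ octant := fun j => (hpos j).le
  obtain ⟨j₀, hj₀⟩ := Finite.exists_min fun j => h j
  have hnorm : 0 < ‖h‖ := (hpos 0).trans_le ((le_abs_self _).trans (abs_coord_le_norm h 0))
  have hδ : 0 < h j₀ / ‖h‖ := div_pos (hpos j₀) hnorm
  obtain ⟨C₁, hC₁⟩ := hl.close _ hδ
  obtain ⟨C₂, hC₂⟩ := hg.exists_abs_sub_timeSep_le hε hlam hcal hδ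
  rw [hT] at hC₁
  have hbound (n : ℕ) : n • |l h - ∑ i, lam i * h i| ≤ C₁ + C₂ := by
    have hn : (0 : ℝ) ≤ n := n.cast_nonneg
    have hmem : (n : ℝ) • h - 0 ∈ innerCone octant (h j₀ / ‖h‖) := by
      rw [sub_zero]
      refine ⟨fun j => mul_nonneg hn (hoct j), le_trans (le_of_eq ?_)
        (le_infDist_frontier_octant fun j => mul_le_mul_of_nonneg_left (hj₀ j) hn)⟩
      rw [norm_smul, Real.norm_of_nonneg hn]
      field_simp
    have hl_close := (hC₁ 0 _ hmem).2
    have hlin_close := (hC₂ 0 _ hmem).2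
    rw [sub_zero, hl.homogeneous n hn h (by rwa [hT])] at hl_close
    rw [sub_zero, sum_mul_smul, abs_sub_comm] at hlin_close
    rw [nsmul_eq_mul, ← abs_of_nonneg hn, ← abs_mul, mul_sub]
    exact (abs_sub_le _ _ _).trans (add_le_add hl_close hlin_close)
  by_contra hne
  obtain ⟨n, hn⟩ := Archimedean.arch (C₁ + C₂ + 1) (abs_pos.2 (sub_ne_zero.2 hne))
  linarith [hbound n]

lemma coe_le_limsup_nhdsWithin_of_tendsto_ray {E : Type*} [NormedAddCommGroup E]
    [NormedSpace ℝ E] {T : Set E} {l : E → ℝ} {h k : E} {c : ℝ}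
    (hT : ∀ s : ℝ, 0 < s → h + s • k ∈ T)
    (hl : Tendsto (fun s : ℝ => l (h + s • k)) (𝓝[>] 0) (𝓝 c)) :
    (c : EReal) ≤ limsup (fun x => (l x : EReal)) (𝓝[T] h) := by
  have hray : Tendsto (fun s : ℝ => h + s • k) (𝓝[>] 0) (𝓝[T] h) :=
    tendsto_nhdsWithin_iff.2
      ⟨(Continuous.tendsto' (by fun_prop) _ _ (by simp)).mono_left nhdsWithin_le_nhds,
        eventually_mem_nhdsWithin.mono hT⟩
  have hlim : limsup (fun x => (l x : EReal)) (map (fun s : ℝ => h + s • k) (𝓝[>] 0)) = c :=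
    ((continuous_coe_real_ereal.tendsto c).comp hl).limsup_eq
  exact hlim.ge.trans (limsup_le_limsup_of_le hray)

lemma IsHedlundMetric.eq_of_isStableTimeSeparation (hg : IsHedlundMetric lam ε g)
    (hε : 0 < ε) (hlam : ∀ i, 0 < lam i) (hcal : Calibrated lam g) {l : E3 → ℝ}
    (hl : IsStableTimeSeparation g l) {h : E3} (hh : h ∈ octant) :
    l h = ∑ i, lam i * h i := by
  have hT := hg.stableTimeCone_eq hε hlam hcal
  have hpos {k : E3} (hk : ∀ j, 0 < k j) : l k = ∑ i, lam i * k i :=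
    hg.eq_of_isStableTimeSeparation_of_pos hε hlam hcal hl hk
  by_cases hint : ∀ j, 0 < h j
  · exact hpos hint
  set k : E3 := WithLp.toLp 2 fun _ => 1
  have hk (j : Fin 3) : 0 < k j := one_pos
  have hray {s : ℝ} (hs : 0 < s) (j : Fin 3) : 0 < (h + s • k) j :=
    add_pos_of_nonneg_of_pos (hh j) (mul_pos hs (hk j))
  apply le_antisymm
  · have hsup := hl.superadditive k (by rw [hT]; exact fun j => (hk j).le) h (by rwa [hT])
    have hone := hpos (hray one_pos)
    rw [one_smul] at hone
    rw [hone, hpos hk, sum_mul_add] at hsup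
    linarith
  · have hmem : h ∈ frontier octant := by
      push Not at hint
      exact (mem_frontier_octant hh).2 hint
    have hbdry := hl.boundary h (by rwa [hT]) (by rwa [hT])
    rw [hT] at hbdry
    have hlin : Tendsto (fun s : ℝ => ∑ i, lam i * (h + s • k) i) (𝓝[>] 0)
        (𝓝 (∑ i, lam i * h i)) :=
      (Continuous.tendsto' (by fun_prop) _ _ (by simp)).mono_left nhdsWithin_le_nhds
    have hle := coe_le_limsup_nhdsWithin_of_tendsto_ray (T := octant)
      (fun s hs j => (hray hs j).le)
      (hlin.congr' (eventually_mem_nhdsWithin.mono fun s hs => (hpos (hray hs)).symm))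
    rwa [← hbdry, EReal.coe_le_coe_iff] at hle

lemma IsHedlundMetric.isStableTimeSeparation_iff (hg : IsHedlundMetric lam ε g) (hε : 0 < ε)
    (hlam : ∀ i, 0 < lam i) (hcal : Calibrated lam g) {l : E3 → ℝ} :
    IsStableTimeSeparation g l ↔ ∀ h ∈ octant, l h = ∑ i, lam i * h i :=
  ⟨fun hl _ hh => hg.eq_of_isStableTimeSeparation hε hlam hcal hl hh,
    fun hl => hg.isStableTimeSeparation_of_eq hε hlam hcal hl⟩

/-! ### The lines are geodesics -/

lemma hasDerivAt_line (i : Fin 3) (t : ℝ) : HasDerivAt (line i) (stdE i) t := by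
  have h : HasDerivAt (line i) ((1 : ℝ) • stdE i) t :=
    ((hasDerivAt_id t).smul_const (stdE i)).const_add (basePt i)
  rwa [one_smul] at h

lemma deriv_line (i : Fin 3) : deriv (line i) = fun _ => stdE i :=
  funext fun t => (hasDerivAt_line i t).deriv

lemma line_mem_lineFamily (i : Fin 3) (t : ℝ) : line i t ∈ lineFamily i :=
  ⟨t, 0, by ext j; simp⟩

lemma line_add (i : Fin 3) (s t : ℝ) : line i (s + t) = line i s + t • stdE i := by
  simp only [line, add_smul, add_assoc]

lemma LorentzMetric.differentiable_lift (g : LorentzMetric) : Differentiable ℝ g.lift :=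
  g.smooth.differentiable (by simp)

lemma LorentzMetric.hasDerivAt_lift_comp (g : LorentzMetric) {γ : ℝ → E3} {v : E3} {t : ℝ}
    (hγ : HasDerivAt γ v t) : HasDerivAt (fun s => g.lift (γ s)) (fderiv ℝ g.lift (γ t) v) t :=
  HasFDerivAt.comp_hasDerivAt (E := E3 →L[ℝ] E3 →L[ℝ] ℝ) t
    (g.differentiable_lift (γ t)).hasFDerivAt hγ

namespace IsHedlundMetric

variable (hg : IsHedlundMetric lam ε g) (hε : 0 < ε)
include hg hε

lemma lift_eq_of_mem_lineFamily {i : Fin 3} {x y : E3} (hx : x ∈ lineFamily i)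
    (hy : y ∈ lineFamily i) : g.lift x = g.lift y := by
  ext v w
  have hx' := g.form_add_smul (proj x) v w 1
  have hy' := g.form_add_smul (proj y) v w 1
  simp only [hg.form_eq_tubeForm hε hx] at hx'
  simp only [hg.form_eq_tubeForm hε hy] at hy'
  simp only [LorentzMetric.lift]
  linarith

lemma fderiv_lift_line_stdE (i : Fin 3) (t : ℝ) : fderiv ℝ g.lift (line i t) (stdE i) = 0 := by
  have hconst : (fun s => g.lift (line i s)) = fun _ => g.lift (line i t) := funext fun s =>
    hg.lift_eq_of_mem_lineFamily hε (line_mem_lineFamily i s) (line_mem_lineFamily i t)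
  have hderiv := g.hasDerivAt_lift_comp (hasDerivAt_line i t)
  rw [hconst] at hderiv
  exact hderiv.unique (hasDerivAt_const (F := E3 →L[ℝ] E3 →L[ℝ] ℝ) t (g.lift (line i t)))

lemma isLocalMin_lift_stdE {i : Fin 3} {x : E3} (hx : x ∈ lineFamily i) :
    IsLocalMin (fun y => g.lift y (stdE i) (stdE i)) x := by
  have hnhds : Metric.thickening ε (lineFamily i) ∈ 𝓝 x :=
    Metric.isOpen_thickening.mem_nhds (Metric.self_subset_thickening hε _ hx)
  filter_upwards [hnhds] with y hy
  rw [LorentzMetric.lift, LorentzMetric.lift, hg.form_stdE hε hx]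
  by_cases h : g.form (proj y) (stdE i) (stdE i) ≤ 0
  · rw [← tubeForm_stdE]
    exact hg.tubeForm_le hy h
  · nlinarith [sq_nonneg (lam i)]

lemma fderiv_lift_line_apply_stdE (i : Fin 3) (t : ℝ) (w : E3) :
    fderiv ℝ g.lift (line i t) w (stdE i) (stdE i) = 0 := by
  have hray : HasDerivAt (fun s : ℝ => line i t + s • w) w 0 := by
    simpa using ((hasDerivAt_id (0 : ℝ)).smul_const w).const_add (line i t)
  have hmin := hg.isLocalMin_lift_stdE hε (line_mem_lineFamily i t)
  have hderiv := ((g.hasDerivAt_lift_comp hray).clm_apply (hasDerivAt_const 0 (stdE i))).clm_apply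
    (hasDerivAt_const 0 (stdE i))
  simp only [zero_smul, add_zero, map_zero] at hderiv
  refine IsLocalMin.hasDerivAt_eq_zero ?_ hderiv
  have htend : Tendsto (fun s : ℝ => line i t + s • w) (𝓝 0) (𝓝 (line i t)) :=
    Continuous.tendsto' (by fun_prop) _ _ (by simp)
  filter_upwards [htend.eventually hmin] with s hs
  simpa using hs

lemma covAccel_line (i : Fin 3) (t : ℝ) (w : E3) :
    covAccel g (line i t) (stdE i) 0 w = 0 := by
  simp [covAccel, hg.fderiv_lift_line_stdE hε, hg.fderiv_lift_line_apply_stdE hε]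

lemma isGeodesic_line (i : Fin 3) : IsGeodesic g (line i) := by
  refine ⟨by unfold line; fun_prop, fun t w => ?_⟩
  rw [deriv_line, deriv_const]
  exact hg.covAccel_line hε i t w

end IsHedlundMetric

lemma exists_int_of_proj_eq {x y : E3} (h : proj x = proj y) :
    ∃ k : Fin 3 → ℤ, x = y + intVec k := by
  have hcoord (j : Fin 3) : ∃ n : ℤ, (n : ℝ) = x j - y j := by
    have hj : ((x j - y j : ℝ) : UnitAddCircle) = 0 := by
      rw [AddCircle.coe_sub, sub_eq_zero]
      exact congrFun h j
    simpa using (AddCircle.coe_eq_zero_iff 1).1 hj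
  choose k hk using hcoord
  exact ⟨k, by ext j; simp [hk]⟩

lemma periodic_tangentLine (i : Fin 3) : Function.Periodic (tangentLine i) 1 := fun t => by
  have hshift : line i (t + 1) = line i t + intVec (Pi.single i 1) := by
    rw [line_add, one_smul]
    ext j
    simp [stdE_apply, Pi.single_apply]
  rw [tangentLine, tangentLine, hshift, proj_add_int]

/-! ### Global flows of vector fields -/

section ODE

variable {E : Type*} [NormedAddCommGroup E] [NormedSpace ℝ E]

/-- `φ` is a global flow of the vector field `f`: `φ x` is the integral curve of `f`, defined
for all times, that starts at `x`. -/
def IsGlobalFlow (f : E → E) (φ : E → ℝ → E) : Prop :=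
  ∀ x, φ x 0 = x ∧ IsIntegralCurve (φ x) fun _ => f

open scoped Manifold in
lemma exists_isGlobalFlow_of_bounded [CompleteSpace E] {f : E → E} {K L : NNReal}
    (hf : ContDiff ℝ 1 f) (hK : LipschitzWith K f) (hL : ∀ x, ‖f x‖ ≤ L) :
    ∃ φ, IsGlobalFlow f φ := by
  have hloc (y : E) :
      ∃ α : ℝ → E, α 0 = y ∧ IsMIntegralCurveOn (I := 𝓘(ℝ, E)) α f (Ioo (-1) 1) := by
    have hpl : IsPicardLindelof (fun _ => f) (tmin := -1) (tmax := 1)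
        ⟨0, by simp⟩ y L 0 L K :=
      .of_time_independent (fun z _ => hL z) hK.lipschitzOnWith (by simp)
    obtain ⟨α, h0, hα⟩ := hpl.exists_eq_forall_mem_Icc_hasDerivWithinAt₀
    exact ⟨α, h0, fun t ht => ((hα t (Ioo_subset_Icc_self ht)).mono
      Ioo_subset_Icc_self).hasFDerivWithinAt.hasMFDerivWithinAt⟩
  have hglobal (x : E) : ∃ α : ℝ → E, α 0 = x ∧ IsIntegralCurve α fun _ => f := by
    obtain ⟨α, h0, hα⟩ := exists_isMIntegralCurve_of_isMIntegralCurveOn (I := 𝓘(ℝ, E)) (v := f)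
      (contMDiff_vectorSpace_iff_contDiff.2 hf) one_pos hloc x
    refine ⟨α, h0, fun t => ?_⟩
    have hderiv : HasFDerivAt α (.toSpanSingleton ℝ (f (α t))) t := (hα t).hasFDerivAt
    simpa using hderiv.hasDerivAt
  choose φ hφ using hglobal
  exact ⟨φ, hφ⟩

namespace IsGlobalFlow

variable {f : E → E} {φ : E → ℝ → E} {K : NNReal}

lemma eq_of_apply_eq (hφ : IsGlobalFlow f φ) (hf : LipschitzWith K f) {x : E} {β : ℝ → E}
    (hβ : IsIntegralCurve β fun _ => f) {t : ℝ} (h : φ x t = β t) : φ x = β :=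
  ODE_solution_unique_univ (v := fun _ => f) (s := fun _ => univ) (fun _ => hf.lipschitzOnWith)
    (fun s => ⟨(hφ x).2 s, mem_univ _⟩) (fun s => ⟨hβ s, mem_univ _⟩) h

lemma reverse (hφ : IsGlobalFlow f φ) : IsGlobalFlow (-f) fun x t => φ x (-t) := fun x => by
  refine ⟨by simpa using (hφ x).1, fun t => ?_⟩
  have h := ((hφ x).2 (-t)).scomp t (hasDerivAt_neg t)
  rwa [neg_one_smul] at h

lemma continuous_of_nonneg (hφ : IsGlobalFlow f φ) (hf : LipschitzWith K f) {t : ℝ} (ht : 0 ≤ t) :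
    Continuous fun x => φ x t := by
  refine (LipschitzWith.of_dist_le_mul (K := (Real.exp (K * t)).toNNReal) fun x y => ?_).continuous
  have hcont (z : E) : ContinuousOn (φ z) (Icc 0 t) := fun s _ =>
    ((hφ z).2 s).continuousAt.continuousWithinAt
  have h := dist_le_of_trajectories_ODE (v := fun _ => f) (fun _ => hf)
    (hcont x) (fun s _ => ((hφ x).2 s).hasDerivWithinAt)
    (hcont y) (fun s _ => ((hφ y).2 s).hasDerivWithinAt) le_rfl t ⟨ht, le_rfl⟩
  rwa [(hφ x).1, (hφ y).1, sub_zero, mul_comm, ← Real.coe_toNNReal _ (Real.exp_pos _).le] at h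

lemma continuous (hφ : IsGlobalFlow f φ) (hf : LipschitzWith K f) (t : ℝ) :
    Continuous fun x => φ x t := by
  rcases le_total 0 t with ht | ht
  · exact hφ.continuous_of_nonneg hf ht
  · simpa using hφ.reverse.continuous_of_nonneg hf.neg (neg_nonneg.2 ht)

end IsGlobalFlow

end ODE

/-! ### The pregeodesic vector field -/

lemma periodic_fderiv {E F : Type*} [NormedAddCommGroup E] [NormedSpace ℝ E]
    [NormedAddCommGroup F] [NormedSpace ℝ F] {f : E → F} {c : E} (hf : Function.Periodic f c) :
    Function.Periodic (fderiv ℝ f) c := fun x => by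
  rw [← fderiv_comp_add_right, funext hf]

namespace LorentzMetric

variable (g)

/-- The covector `w ↦ (D_v ḡ)(v, w) - (D_w ḡ)(v, v) / 2`, the part of `covAccel` that does not
depend on the second derivative. -/
def force (x v : E3) : E3 →L[ℝ] ℝ :=
  fderiv ℝ g.lift x v v - (1 / 2 : ℝ) • ((fderiv ℝ g.lift x).flip v).flip v

/-- The second derivative of the geodesic through `x` with velocity `v`. -/
def accel (x v : E3) : E3 := -(g.lift x).inverse (g.force x v)

/-- The second derivative of the pregeodesic through `x` with unit velocity `v` that is parametrized
by arclength: the component of `accel` orthogonal to `v`. -/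
def spray (x v : E3) : E3 := g.accel x v - inner ℝ (g.accel x v) v • v

lemma covAccel_eq (x v a w : E3) : covAccel g x v a w = g.lift x a w + g.force x v w := by
  simp only [covAccel, force, sub_apply, smul_apply,
    ContinuousLinearMap.flip_apply, smul_eq_mul]
  ring

lemma exists_equiv_lift (x : E3) :
    ∃ e : E3 ≃L[ℝ] (E3 →L[ℝ] ℝ), (e : E3 →L[ℝ] (E3 →L[ℝ] ℝ)) = g.lift x := by
  have hinj : Function.Injective (g.lift x) :=
    (injective_iff_map_eq_zero _).2 fun a ha =>
      g.eq_zero_of_forall_form_eq_zero (p := proj x) fun w => congrArg (· w) ha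
  have hsurj : Function.Surjective (g.lift x) :=
    (LinearMap.injective_iff_surjective_of_finrank_eq_finrank (f := (g.lift x).toLinearMap)
      (InnerProductSpace.toDual ℝ E3).toLinearEquiv.finrank_eq).1 hinj
  exact ⟨.ofBijective (g.lift x) (LinearMap.ker_eq_bot.2 hinj) (LinearMap.range_eq_top.2 hsurj),
    by ext; rfl⟩

lemma lift_accel (x v : E3) : g.lift x (g.accel x v) = -g.force x v := by
  obtain ⟨e, he⟩ := g.exists_equiv_lift x
  rw [accel, ← he, ContinuousLinearMap.inverse_equiv]
  simp

lemma covAccel_accel_add_smul (x v : E3) (c : ℝ) (w : E3) :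
    covAccel g x v (g.accel x v + c • v) w = c * g.lift x v w := by
  rw [covAccel_eq, map_add, lift_accel, map_smul]
  simp

variable {g} in
lemma accel_eq_zero {x v : E3} (h : ∀ w, covAccel g x v 0 w = 0) : g.accel x v = 0 := by
  refine g.eq_zero_of_forall_form_eq_zero (p := proj x) fun w => ?_
  change g.lift x (g.accel x v) w = 0
  simpa [covAccel_eq, lift_accel] using h w

set_option maxSynthPendingDepth 3 in
lemma contDiff_force : ContDiff ℝ ∞ fun z : E3 × E3 => g.force z.1 z.2 := by
  have hderiv : ContDiff ℝ ∞ fun z : E3 × E3 => fderiv ℝ g.lift z.1 :=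
    (g.smooth.fderiv_right (by simp)).comp contDiff_fst
  have hflip : ContDiff ℝ ∞ fun z : E3 × E3 => (fderiv ℝ g.lift z.1).flip :=
    (ContinuousLinearMap.flipₗᵢ ℝ E3 E3 (E3 →L[ℝ] ℝ)).toContinuousLinearEquiv.contDiff.comp hderiv
  have hflip' : ContDiff ℝ ∞ fun z : E3 × E3 => ((fderiv ℝ g.lift z.1).flip z.2).flip :=
    (ContinuousLinearMap.flipₗᵢ ℝ E3 E3 ℝ).toContinuousLinearEquiv.contDiff.comp
      (hflip.clm_apply contDiff_snd)
  exact ((hderiv.clm_apply contDiff_snd).clm_apply contDiff_snd).sub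
    ((hflip'.clm_apply contDiff_snd).const_smul (1 / 2 : ℝ))

lemma contDiff_inverse_lift : ContDiff ℝ ∞ fun x => (g.lift x).inverse := by
  refine contDiff_iff_contDiffAt.2 fun x => ?_
  obtain ⟨e, he⟩ := g.exists_equiv_lift x
  have hinv := contDiffAt_map_inverse (n := ∞) e
  rw [he] at hinv
  exact hinv.comp x g.smooth.contDiffAt

lemma contDiff_accel : ContDiff ℝ ∞ fun z : E3 × E3 => g.accel z.1 z.2 :=
  ((g.contDiff_inverse_lift.comp contDiff_fst).clm_apply g.contDiff_force).neg

lemma lift_add_intVec (x : E3) (k : Fin 3 → ℤ) : g.lift (x + intVec k) = g.lift x := by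
  rw [lift, proj_add_int, lift]

lemma accel_add_intVec (x v : E3) (k : Fin 3 → ℤ) :
    g.accel (x + intVec k) v = g.accel x v := by
  have hderiv : fderiv ℝ g.lift (x + intVec k) = fderiv ℝ g.lift x :=
    periodic_fderiv (F := E3 →L[ℝ] E3 →L[ℝ] ℝ) (g.lift_add_intVec · k) x
  rw [accel, accel, force, force, hderiv, lift_add_intVec]

end LorentzMetric

/-- A smooth cutoff function on the velocities, equal to `1` on the ball of radius `2` and to `0`
outside the ball of radius `3`. -/
def cutoff : ContDiffBump (0 : E3) := ⟨2, 3, by norm_num, by norm_num⟩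

lemma cutoff_eq_zero {v : E3} (h : 3 < ‖v‖) : cutoff v = 0 :=
  cutoff.zero_of_le_dist (by rw [dist_zero_right]; exact h.le)

lemma cutoff_eq_one {v : E3} (h : ‖v‖ = 1) : cutoff v = 1 :=
  cutoff.one_of_mem_closedBall (by
    rw [mem_closedBall_zero_iff, h]
    exact one_le_two)

namespace LorentzMetric

variable (g)

/-- The vector field on the tangent bundle whose integral curves of unit speed are the pregeodesics
parametrized by arclength; the cutoff makes it bounded, hence complete. -/
def pregeodesicField (z : E3 × E3) : E3 × E3 :=
  (cutoff z.2 • z.2, cutoff z.2 • g.spray z.1 z.2)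

lemma pregeodesicField_of_norm_eq_one {z : E3 × E3} (h : ‖z.2‖ = 1) :
    g.pregeodesicField z = (z.2, g.spray z.1 z.2) := by
  simp only [pregeodesicField, cutoff_eq_one h, one_smul]

lemma pregeodesicField_of_lt_norm {z : E3 × E3} (h : 3 < ‖z.2‖) : g.pregeodesicField z = 0 := by
  simp only [pregeodesicField, cutoff_eq_zero h, zero_smul, Prod.mk_zero_zero]

lemma contDiff_pregeodesicField : ContDiff ℝ ∞ g.pregeodesicField := by
  have hcutoff : ContDiff ℝ ∞ fun z : E3 × E3 => cutoff z.2 := cutoff.contDiff.comp contDiff_snd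
  have haccel := g.contDiff_accel
  exact (hcutoff.smul contDiff_snd).prodMk
    (hcutoff.smul (haccel.sub ((haccel.inner ℝ contDiff_snd).smul contDiff_snd)))

lemma pregeodesicField_add_intVec (x v : E3) (k : Fin 3 → ℤ) :
    g.pregeodesicField (x + intVec k, v) = g.pregeodesicField (x, v) := by
  simp only [pregeodesicField, spray, accel_add_intVec]

end LorentzMetric

lemma exists_norm_le_of_periodic {F : Type*} [NormedAddCommGroup F] {f : E3 × E3 → F}
    (hf : Continuous f) (hper : ∀ x v k, f (x + intVec k, v) = f (x, v)) (R : ℝ) :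
    ∃ C : NNReal, ∀ z : E3 × E3, ‖z.2‖ ≤ R → ‖f z‖ ≤ C := by
  obtain ⟨C, hC⟩ := ((isCompact_closedBall (0 : E3) 3).prod
    (isCompact_closedBall (0 : E3) R)).exists_bound_of_continuousOn hf.continuousOn
  refine ⟨C.toNNReal, fun ⟨x, v⟩ hv => ?_⟩
  rw [← hper x v fun j => -⌊x j⌋]
  refine (hC (x + intVec fun j => -⌊x j⌋, v) ⟨?_, mem_closedBall_zero_iff.2 hv⟩).trans
    (Real.le_coe_toNNReal C)
  rw [mem_closedBall_zero_iff]
  have hfract (j : Fin 3) : (x + intVec fun j => -⌊x j⌋) j = Int.fract (x j) := by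
    simp [Int.fract, sub_eq_add_neg]
  calc ‖x + intVec fun j => -⌊x j⌋‖ ≤ ∑ j, |(x + intVec fun j => -⌊x j⌋) j| := norm_le_sum_abs _
    _ ≤ ∑ _j : Fin 3, (1 : ℝ) := Finset.sum_le_sum fun j _ => by
        rw [hfract, Int.abs_fract]
        exact (Int.fract_lt_one _).le
    _ = 3 := by simp

namespace LorentzMetric

variable (g)

lemma exists_norm_pregeodesicField_le : ∃ L : NNReal, ∀ z, ‖g.pregeodesicField z‖ ≤ L := by
  obtain ⟨L, hL⟩ := exists_norm_le_of_periodic g.contDiff_pregeodesicField.continuous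
    g.pregeodesicField_add_intVec 3
  refine ⟨L, fun z => ?_⟩
  rcases le_or_gt ‖z.2‖ 3 with h | h
  · exact hL z h
  · simp [g.pregeodesicField_of_lt_norm h]

lemma exists_lipschitzWith_pregeodesicField : ∃ K, LipschitzWith K g.pregeodesicField := by
  have hper (x v : E3) (k : Fin 3 → ℤ) :
      fderiv ℝ g.pregeodesicField (x + intVec k, v) = fderiv ℝ g.pregeodesicField (x, v) := by
    have hadd : Function.Periodic g.pregeodesicField (intVec k, 0) := fun z => by
      rw [Prod.add_def, add_zero, pregeodesicField_add_intVec]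
    simpa only [Prod.mk_add_mk, add_zero] using periodic_fderiv hadd (x, v)
  obtain ⟨K, hK⟩ := exists_norm_le_of_periodic
    (g.contDiff_pregeodesicField.continuous_fderiv (by simp)) hper 3
  refine ⟨K, lipschitzWith_of_nnnorm_fderiv_le
    (g.contDiff_pregeodesicField.differentiable (by simp)) fun z => ?_⟩
  rcases le_or_gt ‖z.2‖ 3 with h | h
  · exact hK z h
  · have hopen : IsOpen {z : E3 × E3 | 3 < ‖z.2‖} := isOpen_lt continuous_const (by fun_prop)
    have hzero : g.pregeodesicField =ᶠ[𝓝 z] fun _ => 0 := by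
      filter_upwards [hopen.mem_nhds h] with y hy using g.pregeodesicField_of_lt_norm hy
    simp [hzero.fderiv_eq]

end LorentzMetric

/-! ### Integral curves of the pregeodesic vector field -/

lemma eq_zero_of_hasDerivAt_mul {q u : ℝ → ℝ} (hq : Continuous q)
    (hu : ∀ t, HasDerivAt u (q t * u t) t) (h0 : u 0 = 0) (t : ℝ) : u t = 0 := by
  set Q : ℝ → ℝ := fun t => ∫ s in (0 : ℝ)..t, q s
  have hconst (t : ℝ) : HasDerivAt (fun t => u t * Real.exp (-Q t)) 0 t := by
    have hQ : HasDerivAt Q (q t) t := (hq.integral_hasStrictDerivAt 0 t).hasDerivAt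
    have hmul := (hu t).mul hQ.neg.exp
    rwa [show q t * u t * Real.exp ((-Q) t) + u t * (Real.exp ((-Q) t) * -q t) = 0 by ring]
      at hmul
  have heq := is_const_of_deriv_eq_zero (fun t => (hconst t).differentiableAt)
    (fun t => (hconst t).deriv) t 0
  simpa [h0, Real.exp_ne_zero] using heq

section IntegralCurve

variable {α : ℝ → E3 × E3} (hα : IsIntegralCurve α fun _ => g.pregeodesicField)
  (h0 : ‖(α 0).2‖ = 1)
include hα h0

lemma norm_snd_eq_one (t : ℝ) : ‖(α t).2‖ = 1 := by
  have hcont : Continuous α := continuous_iff_continuousAt.2 fun t => (hα t).continuousAt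
  set q : ℝ → ℝ := fun t => -2 * (cutoff (α t).2 * inner ℝ (g.accel (α t).1 (α t).2) (α t).2)
  have hq : Continuous q := continuous_const.mul ((cutoff.continuous.comp hcont.snd).mul
    ((g.contDiff_accel.continuous.comp hcont).inner hcont.snd))
  have hderiv (t : ℝ) :
      HasDerivAt (fun t => ‖(α t).2‖ ^ 2 - 1) (q t * (‖(α t).2‖ ^ 2 - 1)) t := by
    have hsnd : HasDerivAt (fun t => (α t).2) (cutoff (α t).2 • g.spray (α t).1 (α t).2) t :=
      (hα t).snd
    have hslope : 2 * inner ℝ (α t).2 (cutoff (α t).2 • g.spray (α t).1 (α t).2) =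
        q t * (‖(α t).2‖ ^ 2 - 1) := by
      simp only [q, LorentzMetric.spray, inner_smul_right, inner_sub_right,
        real_inner_self_eq_norm_sq]
      rw [real_inner_comm (g.accel (α t).1 (α t).2)]
      ring
    rw [← hslope]
    exact hsnd.norm_sq.sub_const 1
  have hsq := eq_zero_of_hasDerivAt_mul hq hderiv (by simp [h0]) t
  exact (pow_eq_one_iff_of_nonneg (norm_nonneg _) two_ne_zero).1 (sub_eq_zero.1 hsq)

lemma hasDerivAt_fst (t : ℝ) : HasDerivAt (fun t => (α t).1) (α t).2 t := by
  have h : HasDerivAt (fun t => (α t).1) (g.pregeodesicField (α t)).1 t := (hα t).fst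
  rwa [g.pregeodesicField_of_norm_eq_one (norm_snd_eq_one hα h0 t)] at h

lemma hasDerivAt_snd (t : ℝ) :
    HasDerivAt (fun t => (α t).2) (g.spray (α t).1 (α t).2) t := by
  have h : HasDerivAt (fun t => (α t).2) (g.pregeodesicField (α t)).2 t := (hα t).snd
  rwa [g.pregeodesicField_of_norm_eq_one (norm_snd_eq_one hα h0 t)] at h

lemma isUnitPregeodesic_fst : IsUnitPregeodesic g fun t => (α t).1 := by
  have hcont : Continuous α := continuous_iff_continuousAt.2 fun t => (hα t).continuousAt
  have haccel : Continuous fun t => g.accel (α t).1 (α t).2 :=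
    g.contDiff_accel.continuous.comp hcont
  have hfst : deriv (fun t => (α t).1) = fun t => (α t).2 :=
    funext fun t => (hasDerivAt_fst hα h0 t).deriv
  have hsnd : deriv (fun t => (α t).2) = fun t => g.spray (α t).1 (α t).2 :=
    funext fun t => (hasDerivAt_snd hα h0 t).deriv
  refine ⟨?_, fun t => by rw [hfst]; exact norm_snd_eq_one hα h0 t, fun t => ?_⟩
  · rw [show (2 : WithTop ℕ∞) = 1 + 1 from one_add_one_eq_two.symm, contDiff_succ_iff_deriv]
    refine ⟨fun t => (hasDerivAt_fst hα h0 t).differentiableAt, by simp, ?_⟩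
    rw [hfst, contDiff_one_iff_deriv, hsnd]
    refine ⟨fun t => (hasDerivAt_snd hα h0 t).differentiableAt, ?_⟩
    simp only [LorentzMetric.spray]
    fun_prop
  · refine ⟨-inner ℝ (g.accel (α t).1 (α t).2) (α t).2, fun w => ?_⟩
    rw [hfst, hsnd, ← g.covAccel_accel_add_smul, neg_smul, ← sub_eq_add_neg]
    rfl

end IntegralCurve

/-! ### The pregeodesic flow -/

/-- The section of the covering map `proj` with values in the fundamental domain `(0, 1]³`. -/
def fundamentalLift (p : T3) : E3 :=
  WithLp.toLp 2 fun j => (AddCircle.measurableEquivIoc 1 0 (p j) : ℝ)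

lemma proj_fundamentalLift (p : T3) : proj (fundamentalLift p) = p := by
  ext j
  exact (AddCircle.equivIoc 1 0).symm_apply_apply (p j)

lemma measurable_fundamentalLift : Measurable fundamentalLift :=
  (WithLp.measurable_toLp 2 _).comp <| measurable_pi_lambda _ fun j =>
    measurable_subtype_coe.comp
      ((AddCircle.measurableEquivIoc 1 0).measurable.comp (measurable_pi_apply j))

/-- The section of the covering `E3 × S² → UT` given by `fundamentalLift`. -/
def liftUT (z : UT) : E3 × E3 := (fundamentalLift z.1, z.2)

lemma norm_liftUT_snd (z : UT) : ‖(liftUT z).2‖ = 1 := mem_sphere_zero_iff_norm.1 z.2.2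

lemma measurable_liftUT : Measurable liftUT :=
  (measurable_fundamentalLift.comp measurable_fst).prodMk
    (measurable_subtype_coe.comp measurable_snd)

section Flow

variable {φ : E3 × E3 → ℝ → E3 × E3}

lemma IsGlobalFlow.norm_snd_liftUT (hφ : IsGlobalFlow g.pregeodesicField φ) (z : UT) (t : ℝ) :
    ‖(φ (liftUT z) t).2‖ = 1 :=
  norm_snd_eq_one (hφ _).2 (by rw [(hφ _).1, norm_liftUT_snd]) t

/-- The flow that a global flow of the pregeodesic vector field induces on the unit tangent bundle
of the torus. -/
def pregeodesicFlow (hφ : IsGlobalFlow g.pregeodesicField φ) (t : ℝ) (z : UT) : UT :=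
  (proj (φ (liftUT z) t).1,
    ⟨(φ (liftUT z) t).2, mem_sphere_zero_iff_norm.2 (hφ.norm_snd_liftUT z t)⟩)

variable (hφ : IsGlobalFlow g.pregeodesicField φ)

lemma isPregeodesicFlow_pregeodesicFlow : IsPregeodesicFlow g (pregeodesicFlow hφ) := fun z => by
  have h0 : ‖(φ (liftUT z) 0).2‖ = 1 := hφ.norm_snd_liftUT z 0
  refine ⟨?_, _, isUnitPregeodesic_fst (hφ (liftUT z)).2 h0, fun t =>
    ⟨rfl, (hasDerivAt_fst (hφ (liftUT z)).2 h0 t).deriv.symm⟩⟩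
  simp only [pregeodesicFlow, (hφ _).1, liftUT, proj_fundamentalLift]

lemma measurable_pregeodesicFlow (t : ℝ) : Measurable (pregeodesicFlow hφ t) := by
  obtain ⟨K, hK⟩ := g.exists_lipschitzWith_pregeodesicField
  have hmeas : Measurable fun z => φ (liftUT z) t :=
    (hφ.continuous hK t).measurable.comp measurable_liftUT
  exact (lipschitzWith_proj.continuous.measurable.comp hmeas.fst).prodMk hmeas.snd.subtype_mk

lemma mem_range_tangentLine_iff {i : Fin 3} {x : E3} {v : Metric.sphere (0 : E3) 1} :
    (proj x, v) ∈ range (tangentLine i) ↔ x ∈ lineFamily i ∧ (v : E3) = stdE i := by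
  constructor
  · rintro ⟨s, hs⟩
    simp only [tangentLine, Prod.mk.injEq] at hs
    obtain ⟨k, hk⟩ := exists_int_of_proj_eq hs.1.symm
    exact ⟨⟨s, k, hk⟩, congrArg Subtype.val hs.2.symm⟩
  · rintro ⟨⟨s, k, rfl⟩, hv⟩
    exact ⟨s, Prod.ext (proj_add_int _ _).symm (Subtype.ext hv.symm)⟩

variable (hg : IsHedlundMetric lam ε g) (hε : 0 < ε)
include hg hε

lemma IsHedlundMetric.isIntegralCurve_line (i : Fin 3) (s : ℝ) (k : Fin 3 → ℤ) :
    IsIntegralCurve (fun t => (line i (s + t) + intVec k, stdE i)) fun _ => g.pregeodesicField := by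
  intro t
  have haccel : g.accel (line i (s + t) + intVec k) (stdE i) = 0 := by
    rw [g.accel_add_intVec]
    exact LorentzMetric.accel_eq_zero fun w => hg.covAccel_line hε i _ w
  have hline : HasDerivAt (fun t => line i (s + t) + intVec k) (stdE i) t :=
    ((hasDerivAt_line i (s + t)).comp_const_add s t).add_const _
  have hfield : g.pregeodesicField (line i (s + t) + intVec k, stdE i) = (stdE i, 0) := by
    rw [g.pregeodesicField_of_norm_eq_one (z := (_, stdE i)) (norm_stdE i), LorentzMetric.spray]
    simp [haccel]
  simpa only [hfield] using hline.prodMk (hasDerivAt_const t (stdE i))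

include hφ in
lemma IsHedlundMetric.eq_line_of_apply_eq {z : E3 × E3} {i : Fin 3} {s t : ℝ} {k : Fin 3 → ℤ}
    (h : φ z t = (line i (s + t) + intVec k, stdE i)) (r : ℝ) :
    φ z r = (line i (s + r) + intVec k, stdE i) := by
  obtain ⟨K, hK⟩ := g.exists_lipschitzWith_pregeodesicField
  exact congrFun (hφ.eq_of_apply_eq hK (hg.isIntegralCurve_line hε i s k) h) r

lemma IsHedlundMetric.pregeodesicFlow_tangentLine (i : Fin 3) (t s : ℝ) :
    pregeodesicFlow hφ t (tangentLine i s) = tangentLine i (s + t) := by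
  obtain ⟨k, hk⟩ := exists_int_of_proj_eq (proj_fundamentalLift (proj (line i s)))
  have h0 : φ (liftUT (tangentLine i s)) 0 = (line i (s + 0) + intVec k, stdE i) := by
    rw [(hφ _).1, add_zero]
    exact Prod.ext hk rfl
  have ht := hg.eq_line_of_apply_eq hφ hε h0 t
  exact Prod.ext ((congrArg (proj ∘ Prod.fst) ht).trans (proj_add_int _ _))
    (Subtype.ext (congrArg Prod.snd ht))

lemma IsHedlundMetric.mem_range_of_pregeodesicFlow_mem_range {i : Fin 3} {t : ℝ} {z : UT}
    (hz : pregeodesicFlow hφ t z ∈ range (tangentLine i)) : z ∈ range (tangentLine i) := by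
  obtain ⟨⟨s, k, hk⟩, hv⟩ := mem_range_tangentLine_iff.1 hz
  have ht : φ (liftUT z) t = (line i (s - t + t) + intVec k, stdE i) := by
    rw [sub_add_cancel]
    exact Prod.ext hk hv
  have h0 := hg.eq_line_of_apply_eq hφ hε ht 0
  rw [(hφ _).1] at h0
  rw [← Prod.mk.eta (p := z), ← proj_fundamentalLift z.1, mem_range_tangentLine_iff]
  exact ⟨⟨_, k, congrArg Prod.fst h0⟩, congrArg Prod.snd h0⟩

end Flow

lemma IsHedlundMetric.exists_isPregeodesicFlow (hg : IsHedlundMetric lam ε g) (hε : 0 < ε) :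
    ∃ Φ : ℝ → UT → UT, IsPregeodesicFlow g Φ ∧ (∀ t, Measurable (Φ t)) ∧
      (∀ i t s, Φ t (tangentLine i s) = tangentLine i (s + t)) ∧
      ∀ i t z, Φ t z ∈ range (tangentLine i) → z ∈ range (tangentLine i) := by
  obtain ⟨K, hK⟩ := g.exists_lipschitzWith_pregeodesicField
  obtain ⟨L, hL⟩ := g.exists_norm_pregeodesicField_le
  obtain ⟨φ, hφ⟩ :=
    exists_isGlobalFlow_of_bounded (g.contDiff_pregeodesicField.of_le (by simp)) hK hL
  exact ⟨pregeodesicFlow hφ, isPregeodesicFlow_pregeodesicFlow hφ, measurable_pregeodesicFlow hφ,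
    hg.pregeodesicFlow_tangentLine hφ hε,
    fun _ _ _ => hg.mem_range_of_pregeodesicFlow_mem_range hφ hε⟩

/-! ### The measures on the closed lines -/

lemma continuous_tangentLine (i : Fin 3) : Continuous (tangentLine i) := by
  have hline : Continuous (line i) :=
    continuous_iff_continuousAt.2 fun t => (hasDerivAt_line i t).continuousAt
  exact (lipschitzWith_proj.continuous.comp hline).prodMk continuous_const

lemma image_tangentLine_Icc (i : Fin 3) :
    tangentLine i '' Icc (0 : ℝ) 1 = range (tangentLine i) := by
  simpa using (periodic_tangentLine i).image_Icc one_pos 0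

lemma isClosed_range_tangentLine (i : Fin 3) : IsClosed (range (tangentLine i)) := by
  rw [← image_tangentLine_Icc]
  exact (isCompact_Icc.image (continuous_tangentLine i)).isClosed

instance isProbabilityMeasure_lineMeasure (i : Fin 3) : IsProbabilityMeasure (lineMeasure i) := by
  have : IsProbabilityMeasure (volume.restrict (Icc (0 : ℝ) 1)) := ⟨by simp⟩
  exact Measure.isProbabilityMeasure_map (continuous_tangentLine i).measurable.aemeasurable

lemma lineMeasure_compl_range (i : Fin 3) : lineMeasure i (range (tangentLine i))ᶜ = 0 := by
  rw [lineMeasure, Measure.map_apply (continuous_tangentLine i).measurable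
    (isClosed_range_tangentLine i).measurableSet.compl]
  simp [preimage_compl]

lemma image_support_subset_support_map {X Y : Type*} [TopologicalSpace X] [MeasurableSpace X]
    [OpensMeasurableSpace X] [TopologicalSpace Y] [MeasurableSpace Y] [BorelSpace Y]
    {μ : Measure X} {f : X → Y} (hf : Continuous f) : f '' μ.support ⊆ (μ.map f).support := by
  rintro _ ⟨x, hx, rfl⟩
  rw [Measure.mem_support_iff_forall] at hx ⊢
  exact fun U hU => (hx _ (hf.continuousAt hU)).trans_le
    (Measure.le_map_apply hf.measurable.aemeasurable U)

lemma support_lineMeasure (i : Fin 3) : (lineMeasure i).support = range (tangentLine i) := by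
  refine (Measure.support_subset_of_isClosed (isClosed_range_tangentLine i)
    (lineMeasure_compl_range i)).antisymm ?_
  have hIoo : Ioo (0 : ℝ) 1 ⊆ (volume.restrict (Icc (0 : ℝ) 1)).support := by
    simpa [Measure.support_eq_univ] using
      Measure.interior_inter_support (μ := volume) (s := Icc (0 : ℝ) 1)
  have hIcc : Icc (0 : ℝ) 1 ⊆ (volume.restrict (Icc (0 : ℝ) 1)).support :=
    (closure_Ioo zero_ne_one).symm.subset.trans (closure_minimal hIoo Measure.isClosed_support)
  rw [← image_tangentLine_Icc]
  exact (image_mono hIcc).trans (image_support_subset_support_map (continuous_tangentLine i))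

lemma stdE_injective : Function.Injective stdE := fun i j h => by
  have hi := stdE_apply i i
  rw [h, stdE_apply] at hi
  by_contra hne
  simp [hne] at hi

lemma lineMeasure_injective : Function.Injective lineMeasure := fun i j h => by
  have hmem : tangentLine i 0 ∈ range (tangentLine j) := by
    rw [← support_lineMeasure, ← h, support_lineMeasure]
    exact mem_range_self 0
  exact stdE_injective (mem_range_tangentLine_iff.1 hmem).2

lemma integral_lineMeasure (i : Fin 3) {f : UT → ℝ} (hf : Continuous f) :
    ∫ z, f z ∂lineMeasure i = ∫ t in (0 : ℝ)..1, f (tangentLine i t) := by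
  rw [lineMeasure, integral_map (continuous_tangentLine i).measurable.aemeasurable
    hf.aestronglyMeasurable, intervalIntegral.integral_of_le zero_le_one,
    integral_Icc_eq_integral_Ioc]

lemma integral_tangentLine_add (i : Fin 3) (f : UT → ℝ) (s : ℝ) :
    ∫ t in (0 : ℝ)..1, f (tangentLine i (s + t)) = ∫ t in (0 : ℝ)..1, f (tangentLine i t) := by
  have hper : Function.Periodic (fun t => f (tangentLine i t)) 1 := fun t =>
    congrArg f (periodic_tangentLine i t)
  rw [intervalIntegral.integral_comp_add_left (fun t => f (tangentLine i t)) s]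
  simpa using hper.intervalIntegral_add_eq s 0

lemma rotationClass_lineMeasure (i : Fin 3) : rotationClass (lineMeasure i) = stdE i := by
  ext j
  have hcoord : Continuous fun z : UT => (z.2 : E3) j := by fun_prop
  simp [rotationClass, integral_lineMeasure i hcoord, tangentLine, stdS]

/-! ### The Lorentzian length of unit vectors -/

lemma isOpenQuotientMap_proj : IsOpenQuotientMap proj :=
  (IsOpenQuotientMap.piMap fun _ => QuotientAddGroup.isOpenQuotientMap_mk).comp
    (PiLp.homeomorph 2 fun _ : Fin 3 => ℝ).isOpenQuotientMap

lemma LorentzMetric.continuous_form (g : LorentzMetric) : Continuous g.form :=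
  isOpenQuotientMap_proj.isQuotientMap.continuous_iff.2 g.continuous_lift

/-- The Lorentzian length of a unit vector, for causal vectors. -/
def vecLength (g : LorentzMetric) (z : UT) : ℝ := √(-(g.form z.1 (z.2 : E3) (z.2 : E3)))

lemma continuous_form_apply_self (g : LorentzMetric) :
    Continuous fun z : UT => g.form z.1 (z.2 : E3) (z.2 : E3) := by
  have := g.continuous_form
  fun_prop

lemma continuous_vecLength (g : LorentzMetric) : Continuous (vecLength g) :=
  (continuous_form_apply_self g).neg.sqrt

lemma measurableSet_futureCausal (g : LorentzMetric) :
    MeasurableSet {z : UT | FutureCausal g z.1 (z.2 : E3)} := by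
  have hvOne : Continuous fun z : UT => g.form z.1 (z.2 : E3) vOne := by
    have := g.continuous_form
    fun_prop
  have hsnd : Continuous fun z : UT => (z.2 : E3) := by fun_prop
  exact (hsnd.measurable (measurableSet_singleton (0 : E3)).compl).inter <|
    (measurableSet_le (continuous_form_apply_self g).measurable measurable_const).inter
      (measurableSet_lt hvOne.measurable measurable_const)

variable {Φ : ℝ → UT → UT}

/-! ### Averages along the pregeodesic flow -/

/-- The orbit of `z` under `Φ` is the tangent curve of the projection of the pregeodesic `γ`. -/
def IsOrbitLift (g : LorentzMetric) (Φ : ℝ → UT → UT) (z : UT) (γ : ℝ → E3) : Prop :=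
  IsUnitPregeodesic g γ ∧ ∀ t, (Φ t z).1 = proj (γ t) ∧ ((Φ t z).2 : E3) = deriv γ t

namespace IsOrbitLift

variable {z : UT} {γ : ℝ → E3} (h : IsOrbitLift g Φ z γ)
include h

lemma differentiable : Differentiable ℝ γ := h.1.1.differentiable (by norm_num)

lemma continuous_deriv : Continuous (deriv γ) := h.1.1.continuous_deriv (by norm_num)

lemma continuous_orbit : Continuous fun t => Φ t z := by
  refine Continuous.prodMk ?_ (Continuous.subtype_mk ?_ fun t => (Φ t z).2.2)
  · simp only [(h.2 _).1]
    exact lipschitzWith_proj.continuous.comp h.differentiable.continuous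
  · simpa only [(h.2 _).2] using h.continuous_deriv

lemma vecLength_eq (t : ℝ) : vecLength g (Φ t z) = speed g γ t := by
  rw [vecLength, speed, (h.2 t).1, (h.2 t).2]

lemma isFuturePointing
    (hf : ∀ᵐ t ∂(volume.restrict (Icc (0 : ℝ) 1)), FutureCausal g (Φ t z).1 ((Φ t z).2 : E3)) :
    IsFuturePointing g γ 0 1 := by
  have hlip : LipschitzWith 1 γ :=
    lipschitzWith_of_nnnorm_deriv_le h.differentiable fun t => by
      rw [← NNReal.coe_le_coe, coe_nnnorm, h.1.2.1 t, NNReal.coe_one]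
  refine ⟨one_pos, ⟨1, hlip.lipschitzOnWith⟩, ?_⟩
  filter_upwards [hf] with t ht
  rw [(h.2 t).1, (h.2 t).2] at ht
  exact ⟨h.differentiable t, ht⟩

end IsOrbitLift

/-- The average of a function over a piece of orbit of length one. -/
def orbitAverage (Φ : ℝ → UT → UT) (f : UT → ℝ) (z : UT) : ℝ := ∫ t in (0 : ℝ)..1, f (Φ t z)

/-- The increment of `potential j` along a piece of orbit of length one, see
`IsOrbitLift.potentialGain_eq`. -/
def potentialGain (Φ : ℝ → UT → UT) (j : Fin 3) (z : UT) : ℝ :=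
  orbitAverage Φ (fun z => (z.2 : E3) j) z -
    (correction j (Φ 1 z).1 - correction j (Φ 0 z).1)

lemma IsOrbitLift.potentialGain_eq {z : UT} {γ : ℝ → E3} (h : IsOrbitLift g Φ z γ) (j : Fin 3) :
    potentialGain Φ j z = potential j (γ 1) - potential j (γ 0) := by
  have hcoord (t : ℝ) : HasDerivAt (fun t => γ t j) (deriv γ t j) t :=
    (EuclideanSpace.proj j : E3 →L[ℝ] ℝ).hasFDerivAt.comp_hasDerivAt t
      (h.differentiable t).hasDerivAt
  have hcont : Continuous fun t => deriv γ t j := by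
    have := h.continuous_deriv
    fun_prop
  have hint := intervalIntegral.integral_eq_sub_of_hasDerivAt (a := 0) (b := 1)
    (fun t _ => hcoord t) (hcont.intervalIntegrable 0 1)
  simp only [potentialGain, orbitAverage, (h.2 _).1, (h.2 _).2, hint, potential]
  ring

lemma IsPregeodesicFlow.measurable_uncurry (hΦ : IsPregeodesicFlow g Φ)
    (hm : ∀ t, Measurable (Φ t)) : Measurable (Function.uncurry Φ) :=
  measurable_uncurry_of_continuous_of_measurable
    (fun z => let ⟨_, _, h⟩ := hΦ z; IsOrbitLift.continuous_orbit h) hm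

section Invariant

lemma integrable_of_continuous {X : Type*} [TopologicalSpace X] [CompactSpace X]
    [MeasurableSpace X] [OpensMeasurableSpace X] {μ : Measure X} [IsFiniteMeasure μ] {f : X → ℝ}
    (hf : Continuous f) : Integrable f μ :=
  (BoundedContinuousFunction.mkOfCompact ⟨f, hf⟩).integrable μ

variable {μ : Measure UT} (hμ : ∀ t, MeasurePreserving (Φ t) μ μ)

include hμ in
lemma integral_comp_flow {f : UT → ℝ} (hf : Continuous f) (t : ℝ) :
    ∫ z, f (Φ t z) ∂μ = ∫ z, f z ∂μ := by
  conv_rhs => rw [← (hμ t).map_eq]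
  rw [integral_map (hμ t).measurable.aemeasurable hf.aestronglyMeasurable]

include hμ in
lemma integrable_correction_comp_flow [IsFiniteMeasure μ] (j : Fin 3) (t : ℝ) :
    Integrable (fun z => correction j (Φ t z).1) μ :=
  (hμ t).integrable_comp_of_integrable <| integrable_of_continuous <|
    (lipschitzWith_correction j).continuous.comp continuous_fst

variable [IsFiniteMeasure μ] (hΦ : IsPregeodesicFlow g Φ)
include hμ hΦ

lemma integrable_orbit {f : UT → ℝ} (hf : Continuous f) :
    Integrable (fun p : ℝ × UT => f (Φ p.1 p.2)) ((volume.restrict (uIoc (0 : ℝ) 1)).prod μ) := by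
  obtain ⟨C, hC⟩ := isCompact_univ.exists_bound_of_continuousOn hf.continuousOn
  have hu := hΦ.measurable_uncurry fun t => (hμ t).measurable
  have : IsFiniteMeasure (volume.restrict (uIoc (0 : ℝ) 1)) := ⟨by simp⟩
  exact Integrable.of_bound (hf.measurable.comp hu).aestronglyMeasurable C
    (Eventually.of_forall fun p => hC _ (mem_univ _))

lemma integrable_orbitAverage {f : UT → ℝ} (hf : Continuous f) :
    Integrable (orbitAverage Φ f) μ := by
  have h := (integrable_orbit hμ hΦ hf).integral_prod_right
  simp only [uIoc_of_le zero_le_one, ← intervalIntegral.integral_of_le zero_le_one] at h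
  exact h

lemma integral_orbitAverage {f : UT → ℝ} (hf : Continuous f) :
    ∫ z, orbitAverage Φ f z ∂μ = ∫ z, f z ∂μ := by
  unfold orbitAverage
  rw [← intervalIntegral_integral_swap (integrable_orbit hμ hΦ hf)]
  simp [integral_comp_flow hμ hf]

lemma integrable_potentialGain (j : Fin 3) : Integrable (potentialGain Φ j) μ := by
  exact (integrable_orbitAverage hμ hΦ (by fun_prop)).sub <|
    (integrable_correction_comp_flow hμ j 1).sub (integrable_correction_comp_flow hμ j 0)

lemma integral_potentialGain (j : Fin 3) : ∫ z, potentialGain Φ j z ∂μ = rotationClass μ j := by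
  have hcorr : Continuous fun z : UT => correction j z.1 :=
    (lipschitzWith_correction j).continuous.comp continuous_fst
  have hint := integrable_correction_comp_flow hμ j
  have hcoord : Continuous fun z : UT => (z.2 : E3) j := by fun_prop
  have hdiff : Integrable (fun z => correction j (Φ 1 z).1 - correction j (Φ 0 z).1) μ :=
    (hint 1).sub (hint 0)
  unfold potentialGain
  rw [integral_sub (integrable_orbitAverage hμ hΦ hcoord) hdiff,
    integral_sub (hint 1) (hint 0), integral_comp_flow hμ hcorr, integral_comp_flow hμ hcorr,
    integral_orbitAverage hμ hΦ hcoord, sub_self, sub_zero, rotationClass]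

lemma ae_exists_isFuturePointing (hfut : ∀ᵐ z ∂μ, FutureCausal g z.1 (z.2 : E3)) :
    ∀ᵐ z ∂μ, ∃ γ, IsOrbitLift g Φ z γ ∧ IsFuturePointing g γ 0 1 := by
  have hu := hΦ.measurable_uncurry fun t => (hμ t).measurable
  have hae : ∀ᵐ z ∂μ, ∀ᵐ t ∂(volume.restrict (Icc (0 : ℝ) 1)),
      FutureCausal g (Φ t z).1 ((Φ t z).2 : E3) := by
    rw [Measure.ae_ae_comm (p := fun z t => FutureCausal g (Φ t z).1 ((Φ t z).2 : E3))
      (hu.comp measurable_swap (measurableSet_futureCausal g))]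
    exact Eventually.of_forall fun t => (hμ t).quasiMeasurePreserving.ae hfut
  filter_upwards [hae] with z hz
  obtain ⟨-, γ, h⟩ := hΦ z
  exact ⟨γ, h, IsOrbitLift.isFuturePointing h hz⟩

end Invariant

/-! ### Maximal ergodic measures -/

lemma mem_range_of_mem_lineFamily {i : Fin 3} {x : E3} {v : Metric.sphere (0 : E3) 1}
    (hx : x ∈ lineFamily i) (hi : 0 < (v : E3) i) (hj : ∀ j ≠ i, (v : E3) j = 0) :
    (proj x, v) ∈ range (tangentLine i) := by
  refine mem_range_tangentLine_iff.2 ⟨hx, ?_⟩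
  have hv : (v : E3) = (v : E3) i • stdE i := by
    ext j
    by_cases h : j = i
    · simp [h, stdE_apply]
    · simp [h, stdE_apply, hj j h]
  have hnorm := mem_sphere_zero_iff_norm.1 v.2
  rw [hv, norm_smul, norm_stdE, mul_one, Real.norm_of_nonneg hi.le] at hnorm
  rw [hv, hnorm, one_smul]

lemma averageLength_eq (g : LorentzMetric) (μ : Measure UT) :
    averageLength g μ = ∫ z, vecLength g z ∂μ := rfl

section Maximal

variable {μ : Measure UT} [IsFiniteMeasure μ] (hμ : ∀ t, MeasurePreserving (Φ t) μ μ)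
  (hΦ : IsPregeodesicFlow g Φ) (hcal : Calibrated lam g)
  (hfut : ∀ᵐ z ∂μ, FutureCausal g z.1 (z.2 : E3))
include hμ hΦ hcal hfut

lemma rotationClass_mem_octant : rotationClass μ ∈ octant := fun j => by
  rw [← integral_potentialGain hμ hΦ]
  refine integral_nonneg_of_ae ?_
  filter_upwards [ae_exists_isFuturePointing hμ hΦ hfut] with z ⟨γ, h, hγ⟩
  rw [h.potentialGain_eq]
  exact sub_nonneg.2 (hcal.potential_le_potential hγ j)

lemma ae_orbitAverage_vecLength_le (hlam : ∀ i, 0 ≤ lam i) :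
    ∀ᵐ z ∂μ, orbitAverage Φ (vecLength g) z ≤ ∑ j, lam j * potentialGain Φ j z := by
  filter_upwards [ae_exists_isFuturePointing hμ hΦ hfut] with z ⟨γ, h, hγ⟩
  have hle := hcal.lorentzLength_le hlam hγ
  rw [hγ.lorentzLength_eq] at hle
  simpa only [orbitAverage, h.vecLength_eq, h.potentialGain_eq] using hle

lemma ae_orbitAverage_vecLength_eq (hlam : ∀ i, 0 ≤ lam i)
    (hmax : averageLength g μ = ∑ i, lam i * rotationClass μ i) :
    ∀ᵐ z ∂μ, orbitAverage Φ (vecLength g) z = ∑ j, lam j * potentialGain Φ j z := by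
  have hlen := integrable_orbitAverage hμ hΦ (continuous_vecLength g)
  have hgain (j : Fin 3) : Integrable (fun z => lam j * potentialGain Φ j z) μ :=
    (integrable_potentialGain hμ hΦ j).const_mul (lam j)
  refine (integral_eq_iff_of_ae_le hlen (integrable_finsetSum _ fun j _ => hgain j)
    (ae_orbitAverage_vecLength_le hμ hΦ hcal hfut hlam)).1 ?_
  rw [integral_orbitAverage hμ hΦ (continuous_vecLength g), integral_finsetSum _ fun j _ => hgain j]
  simpa only [integral_const_mul, integral_potentialGain hμ hΦ, averageLength_eq] using hmax

lemma ae_mem_range_tangentLine (hlam : ∀ i, 0 ≤ lam i)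
    (hmax : averageLength g μ = ∑ i, lam i * rotationClass μ i)
    (hback : ∀ i t z, Φ t z ∈ range (tangentLine i) → z ∈ range (tangentLine i)) :
    ∀ᵐ z ∂μ, ∃ i, z ∈ range (tangentLine i) := by
  filter_upwards [ae_exists_isFuturePointing hμ hΦ hfut,
    ae_orbitAverage_vecLength_eq hμ hΦ hcal hfut hlam hmax] with z ⟨γ, h, hγ⟩ heq
  have hspeed : IntervalIntegrable (speed g γ) volume 0 1 := by
    have hcont := (continuous_vecLength g).comp h.continuous_orbit
    simpa only [Function.comp_def, h.vecLength_eq] using hcont.intervalIntegrable 0 1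
  have hne : (ae (volume.restrict (Icc (0 : ℝ) 1))).NeBot := by
    rw [ae_neBot, Ne, Measure.restrict_eq_zero]
    simp
  obtain ⟨t, i, hmem, hpos, hzero⟩ := (hcal.ae_mem_lineFamily_of_length_eq hlam hγ hspeed
    (by simpa only [orbitAverage, h.vecLength_eq, h.potentialGain_eq] using heq)).exists
  rw [← (h.2 t).2] at hpos hzero
  refine ⟨i, hback i t z ?_⟩
  rw [← Prod.mk.eta (p := Φ t z), (h.2 t).1]
  exact mem_range_of_mem_lineFamily hmem hpos hzero

end Maximal

section Line

variable (hline : ∀ i t s, Φ t (tangentLine i s) = tangentLine i (s + t))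
include hline

lemma eq_lineMeasure (hΦ : IsPregeodesicFlow g Φ) {μ : Measure UT} [IsProbabilityMeasure μ]
    (hμ : ∀ t, MeasurePreserving (Φ t) μ μ) {i : Fin 3}
    (hi : ∀ᵐ z ∂μ, z ∈ range (tangentLine i)) : μ = lineMeasure i := by
  refine ext_of_forall_integral_eq_of_IsFiniteMeasure fun f => ?_
  have hconst : orbitAverage Φ f =ᵐ[μ] fun _ => ∫ z, f z ∂lineMeasure i := by
    filter_upwards [hi]
    rintro _ ⟨s, rfl⟩
    simp only [orbitAverage, hline, integral_tangentLine_add, integral_lineMeasure i f.continuous]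
  rw [← integral_orbitAverage hμ hΦ f.continuous, integral_congr_ae hconst]
  simp

lemma measurePreserving_lineMeasure (hm : ∀ t, Measurable (Φ t)) (i : Fin 3) (t : ℝ) :
    MeasurePreserving (Φ t) (lineMeasure i) (lineMeasure i) := by
  refine ⟨hm t, ?_⟩
  have htm := (continuous_tangentLine i).measurable
  have := Measure.isProbabilityMeasure_map (μ := lineMeasure i) (hm t).aemeasurable
  refine ext_of_forall_integral_eq_of_IsFiniteMeasure fun f => ?_
  have hmap : (lineMeasure i).map (Φ t) =
      (volume.restrict (Icc (0 : ℝ) 1)).map fun s => tangentLine i (s + t) := by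
    rw [lineMeasure, Measure.map_map (hm t) htm]
    simp only [Function.comp_def, hline]
  rw [hmap, integral_map (by fun_prop) f.continuous.aestronglyMeasurable,
    integral_Icc_eq_integral_Ioc, ← intervalIntegral.integral_of_le zero_le_one,
    integral_lineMeasure i f.continuous, ← integral_tangentLine_add i _ t]
  simp only [add_comm]

lemma lineMeasure_eq_zero_or_compl_eq_zero (i : Fin 3) {A : Set UT} (hinv : ∀ t, Φ t ⁻¹' A = A) :
    lineMeasure i A = 0 ∨ lineMeasure i Aᶜ = 0 := by
  have hmem (s : ℝ) : tangentLine i s ∈ A ↔ tangentLine i 0 ∈ A := by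
    rw [← zero_add s, ← hline, ← mem_preimage, hinv]
  by_cases h0 : tangentLine i 0 ∈ A
  · refine Or.inr (measure_mono_null ?_ (lineMeasure_compl_range i))
    rintro _ hz ⟨s, rfl⟩
    exact hz ((hmem s).2 h0)
  · refine Or.inl (measure_mono_null ?_ (lineMeasure_compl_range i))
    rintro _ hz ⟨s, rfl⟩
    exact h0 ((hmem s).1 hz)

end Line

section LineMeasure

variable (hg : IsHedlundMetric lam ε g) (hε : 0 < ε) (hlam : ∀ i, 0 < lam i)
include hg hε hlam

lemma IsHedlundMetric.averageLength_lineMeasure (i : Fin 3) :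
    averageLength g (lineMeasure i) = lam i := by
  have hlen (t : ℝ) : vecLength g (tangentLine i t) = lam i := by
    rw [vecLength, tangentLine, stdS, hg.form_stdE hε (line_mem_lineFamily i t), neg_neg,
      Real.sqrt_sq (hlam i).le]
  rw [averageLength_eq, integral_lineMeasure i (continuous_vecLength g)]
  simp [hlen]

lemma IsHedlundMetric.isMaximalErgodic_lineMeasure (hm : ∀ t, Measurable (Φ t))
    (hline : ∀ i t s, Φ t (tangentLine i s) = tangentLine i (s + t)) {l : E3 → ℝ}
    (hl : ∀ h ∈ octant, l h = ∑ i, lam i * h i) (i : Fin 3) :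
    IsMaximalErgodic g Φ l (lineMeasure i) where
  prob := inferInstance
  invariant := measurePreserving_lineMeasure hline hm i
  ergodic _ _ hinv := lineMeasure_eq_zero_or_compl_eq_zero hline i hinv
  future := by
    rw [lineMeasure, ae_map_iff (continuous_tangentLine i).measurable.aemeasurable
      (measurableSet_futureCausal g)]
    exact Eventually.of_forall fun s =>
      hg.futureCausal_stdE hε (hlam i) (line_mem_lineFamily i s)
  maximal := by
    rw [hg.averageLength_lineMeasure hε hlam, rotationClass_lineMeasure, hl _ (stdE_mem_octant i)]
    simp [stdE_apply]

end LineMeasure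

lemma IsMaximalErgodic.mem_range_lineMeasure (hcal : Calibrated lam g) (hlam : ∀ i, 0 ≤ lam i)
    (hΦ : IsPregeodesicFlow g Φ)
    (hline : ∀ i t s, Φ t (tangentLine i s) = tangentLine i (s + t))
    (hback : ∀ i t z, Φ t z ∈ range (tangentLine i) → z ∈ range (tangentLine i))
    {l : E3 → ℝ} (hl : ∀ h ∈ octant, l h = ∑ i, lam i * h i) {μ : Measure UT}
    (hμ : IsMaximalErgodic g Φ l μ) : μ ∈ range lineMeasure := by
  have := hμ.prob
  have hmax := hμ.maximal
  rw [hl _ (rotationClass_mem_octant hμ.invariant hΦ hcal hμ.future)] at hmax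
  have hae := ae_mem_range_tangentLine hμ.invariant hΦ hcal hμ.future hlam hmax hback
  have hinv (i t) : Φ t ⁻¹' range (tangentLine i) = range (tangentLine i) := by
    refine Subset.antisymm (hback i t) ?_
    rintro _ ⟨s, rfl⟩
    exact ⟨s + t, (hline i t s).symm⟩
  have hfull : ∃ i, μ (range (tangentLine i))ᶜ = 0 := by
    by_contra! hcon
    have hnull (i : Fin 3) : μ (range (tangentLine i)) = 0 :=
      (hμ.ergodic _ (isClosed_range_tangentLine i).measurableSet (hinv i)).resolve_right (hcon i)
    have hnone : ∀ᵐ z ∂μ, ∀ i, z ∉ range (tangentLine i) :=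
      ae_all_iff.2 fun i => measure_eq_zero_iff_ae_notMem.1 (hnull i)
    obtain ⟨z, ⟨i, hi⟩, hz⟩ := (hae.and hnone).exists
    exact hz i hi
  obtain ⟨i, hi⟩ := hfull
  exact ⟨i, (eq_lineMeasure hline hΦ hμ.invariant hi).symm⟩

end Hedlund

end

open Hedlund in
theorem propositionP30_general (lam : Fin 3 → ℝ) (hlam : ∀ i, 0 < lam i)
    (ε : ℝ) (hε : 0 < ε) (hε' : ε < 1 / 100)
    (hsmall : ∀ i, 3 * ε ^ 2 < (1 - 2 * ε ^ 2) * lam i ^ 2)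
    (g : LorentzMetric) (hg : IsHedlundMetric lam ε g) :
    stableTimeCone g = (PointedCone.hull ℝ {stdE 0, stdE 1, stdE 2} : Set E3) ∧
    (∀ l : E3 → ℝ, IsStableTimeSeparation g l ↔
      ∀ h ∈ PointedCone.hull ℝ {stdE 0, stdE 1, stdE 2}, l h = ∑ i, lam i * h i) ∧
    (∀ i, IsGeodesic g (line i) ∧ (∀ t, FutureCausal g (proj (line i t)) (deriv (line i) t) ∧
        g.lift (line i t) (deriv (line i) t) (deriv (line i) t) < 0) ∧
      Function.Periodic (fun t => proj (line i t)) 1) ∧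
    Function.Injective lineMeasure ∧
    (∀ i, (lineMeasure i).support = Set.range (tangentLine i)) ∧
    ∃ Φ : ℝ → UT → UT, IsPregeodesicFlow g Φ ∧
      ∀ l : E3 → ℝ, IsStableTimeSeparation g l →
        {μ : Measure UT | IsMaximalErgodic g Φ l μ} = Set.range lineMeasure := by
  have hcal := hg.calibrated hlam hε hε' hsmall
  have hmem (h : E3) : h ∈ PointedCone.hull ℝ {stdE 0, stdE 1, stdE 2} ↔ h ∈ octant := by
    rw [← SetLike.mem_coe, hull_stdE_eq_octant]
  have hsep (l : E3 → ℝ) : IsStableTimeSeparation g l ↔ ∀ h ∈ octant, l h = ∑ i, lam i * h i :=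
    hg.isStableTimeSeparation_iff hε hlam hcal
  obtain ⟨Φ, hΦ, hmeas, hline, hback⟩ := hg.exists_isPregeodesicFlow hε
  refine ⟨?_, ?_, fun i => ⟨hg.isGeodesic_line hε i, fun t => ?_, fun t => ?_⟩,
    lineMeasure_injective, support_lineMeasure, Φ, hΦ, fun l hl => ?_⟩
  · rw [hull_stdE_eq_octant, hg.stableTimeCone_eq hε hlam hcal]
  · simpa only [hmem] using hsep
  · have hx := line_mem_lineFamily i t
    rw [deriv_line, LorentzMetric.lift, hg.form_stdE hε hx, neg_lt_zero]
    exact ⟨hg.futureCausal_stdE hε (hlam i) hx, pow_pos (hlam i) 2⟩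
  · exact congrArg Prod.fst (periodic_tangentLine i t)
  · refine Set.Subset.antisymm (fun μ hμ => IsMaximalErgodic.mem_range_lineMeasure hcal
      (fun i => (hlam i).le) hΦ hline hback ((hsep l).1 hl) hμ) ?_
    rintro _ ⟨i, rfl⟩
    exact hg.isMaximalErgodic_lineMeasure hε hlam hmeas hline ((hsep l).1 hl) i

open Hedlund in
theorem propositionP30 (lam : Fin 3 → ℝ) (hlam : ∀ i, 0 < lam i) (hsum : ∑ i, lam i = 1)
    (ε : ℝ) (hε : 0 < ε) (hε' : ε < 1 / 100)
    (hsmall : ∀ i, 3 * ε ^ 2 < (1 - 2 * ε ^ 2) * lam i ^ 2)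
    (g : LorentzMetric) (hg : IsHedlundMetric lam ε g) :
    stableTimeCone g = (PointedCone.hull ℝ {stdE 0, stdE 1, stdE 2} : Set E3) ∧
    (∀ l : E3 → ℝ, IsStableTimeSeparation g l ↔
      ∀ h ∈ PointedCone.hull ℝ {stdE 0, stdE 1, stdE 2}, l h = ∑ i, lam i * h i) ∧
    (∀ i, IsGeodesic g (line i) ∧ (∀ t, FutureCausal g (proj (line i t)) (deriv (line i) t) ∧
        g.lift (line i t) (deriv (line i) t) (deriv (line i) t) < 0) ∧
      Function.Periodic (fun t => proj (line i t)) 1) ∧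
    Function.Injective lineMeasure ∧
    (∀ i, (lineMeasure i).support = Set.range (tangentLine i)) ∧
    ∃ Φ : ℝ → UT → UT, IsPregeodesicFlow g Φ ∧
      ∀ l : E3 → ℝ, IsStableTimeSeparation g l →
        {μ : Measure UT | IsMaximalErgodic g Φ l μ} = Set.range lineMeasure := by
  exact propositionP30_general lam hlam ε hε hε' hsmall g hg
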